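/- A *graphon* is a bounded measurable function $W:[0,1]^2\to\mathbb{R}$ that is symmetric, i.e. $W(x,y)=W(y,x)$ for all $x,y\in[0,1]$. For a finite simple graph $F$ with vertex set $V(F)=\{1,\dots,k\}$ and edge set $E(F)$, put $$t(F,W)=\int_{[0,1]^k}\prod_{ij\in E(F)}W(x_i,x_j)\,dx_1\cdots dx_k .$$ Let $\mathcal{M}$ be the set of probability measures on $[0,1]^2$ both of whose marginals are the Lebesgue measure on $[0,1]$. For two graphons $W,W'$, put $$\delta_\square(W,W')=\inf_{\mu\in\mathcal{M}}\ \sup_{S,T\subseteq[0,1]^2}\ \Bigl|\int_{(x,u)\in S,\ (y,v)\in T}\bigl(W(x,y)-W'(u,v)\bigr)\,d\mu(x,u)\,d\mu(y,v)\Bigr| ,$$ where the supremum is over all pairs of measurable sets $S,T$. Then, for any two graphons $W$ and $W'$, $\delta_\square(W,W')=0$ if and only if $t(F,W)=t(F,W')$ for every finite simple graph $F$. -/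

import Mathlib

open MeasureTheory

/-- A graphon: a bounded, symmetric, Lebesgue measurable function `[0,1]² → ℝ`.
Values are arbitrary reals. Being a.e. measurable for the Lebesgue measure (equal almost
everywhere to a Borel function) is the same as being Lebesgue measurable. -/
structure Graphon where
  /-- the underlying function -/
  toFun : unitInterval → unitInterval → ℝ
  symm' : ∀ x y, toFun x y = toFun y x
  bounded' : ∃ C : ℝ, ∀ x y, |toFun x y| ≤ C
  aemeasurable' : AEMeasurable (Function.uncurry toFun)
    (volume : Measure (unitInterval × unitInterval))

namespace Graphon

instance : CoeFun Graphon (fun _ => unitInterval → unitInterval → ℝ) := ⟨Graphon.toFun⟩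

/-- The value of a graphon on an unordered pair of points. -/
def onSym2 (W : Graphon) : Sym2 unitInterval → ℝ :=
  Sym2.lift ⟨fun x y => W x y, W.symm'⟩

open Classical in
/-- The homomorphism density `t(F, W) = ∫_{[0,1]^V} ∏_{ij ∈ E(F)} W(x_i, x_j) dx`
of a finite simple graph in a graphon. -/
noncomputable def homDensity {V : Type*} [Fintype V] (F : SimpleGraph V) (W : Graphon) : ℝ :=
  ∫ x : V → unitInterval, ∏ e ∈ F.edgeFinset, W.onSym2 (e.map x)

/-- Couplings of the uniform distribution on `[0,1]` with itself: the probability measures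
on `[0,1]²` both of whose marginals are the Lebesgue measure. -/
def couplings : Set (Measure (unitInterval × unitInterval)) :=
  {μ | IsProbabilityMeasure μ ∧ μ.map Prod.fst = volume ∧ μ.map Prod.snd = volume}

/-- `∫_{(x,u) ∈ S, (y,v) ∈ T} (W(x,y) - W'(u,v)) dμ(x,u) dμ(y,v)`. -/
noncomputable def overlayIntegral (W W' : Graphon) (μ : Measure (unitInterval × unitInterval))
    (S T : Set (unitInterval × unitInterval)) : ℝ :=
  ∫ p in S ×ˢ T, (W p.1.1 p.2.1 - W' p.1.2 p.2.2) ∂(μ.prod μ)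

/-- The cut distance of two graphons overlaid by `μ`: the supremum of `|overlayIntegral|`
over all pairs of measurable subsets of `[0,1]²`. -/
noncomputable def overlayCutDist (W W' : Graphon)
    (μ : Measure (unitInterval × unitInterval)) : ℝ :=
  ⨆ ST : {S : Set (unitInterval × unitInterval) // MeasurableSet S} ×
      {T : Set (unitInterval × unitInterval) // MeasurableSet T},
    |overlayIntegral W W' μ ST.1 ST.2|

/-- The cut distance `δ_□(W, W')`: the infimum over all couplings. -/
noncomputable def cutDist (W W' : Graphon) : ℝ :=
  ⨅ μ : couplings, overlayCutDist W W' μ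

/-- The supremum in `overlayCutDist` is over a bounded family. -/
theorem bddAbove_overlayIntegral (W W' : Graphon) {μ : Measure (unitInterval × unitInterval)}
    (hμ : μ ∈ couplings) :
    BddAbove (Set.range fun ST : {S : Set (unitInterval × unitInterval) // MeasurableSet S} ×
      {T : Set (unitInterval × unitInterval) // MeasurableSet T} =>
        |overlayIntegral W W' μ ST.1 ST.2|) := by
  obtain ⟨C, hC⟩ := W.bounded'
  obtain ⟨C', hC'⟩ := W'.bounded'
  have := hμ.1
  have h0 : 0 ≤ C := (abs_nonneg _).trans (hC 0 0)
  have h0' : 0 ≤ C' := (abs_nonneg _).trans (hC' 0 0)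
  refine ⟨C + C', ?_⟩
  rintro _ ⟨⟨⟨S, hS⟩, ⟨T, hT⟩⟩, rfl⟩
  have h := norm_setIntegral_le_of_norm_le_const (μ := μ.prod μ) (s := S ×ˢ T)
    (f := fun p => W p.1.1 p.2.1 - W' p.1.2 p.2.2) (C := C + C')
    (measure_lt_top _ _)
    (fun p _ => (abs_sub _ _).trans (add_le_add (hC _ _) (hC' _ _)))
  refine h.trans (mul_le_of_le_one_right (add_nonneg h0 h0') ?_)
  exact measureReal_le_one

/-- The infimum in `cutDist` is over a nonempty family: the product measure is a coupling. -/
theorem nonempty_couplings : couplings.Nonempty :=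
  ⟨volume, inferInstance, by
    rw [Measure.volume_eq_prod]
    exact ⟨by simp, by simp⟩⟩

/-- The integrand of `overlayIntegral` is integrable. -/
theorem integrable_overlay (W W' : Graphon) {μ : Measure (unitInterval × unitInterval)}
    (hμ : μ ∈ couplings) :
    Integrable (fun p : (unitInterval × unitInterval) × (unitInterval × unitInterval) =>
      W p.1.1 p.2.1 - W' p.1.2 p.2.2) (μ.prod μ) := by
  have := hμ.1
  have h1 : MeasurePreserving Prod.fst μ volume := ⟨measurable_fst, hμ.2.1⟩
  have h2 : MeasurePreserving Prod.snd μ volume := ⟨measurable_snd, hμ.2.2⟩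
  have key : ∀ (U : Graphon) (f : unitInterval × unitInterval → unitInterval),
      MeasurePreserving f μ volume →
      Integrable (fun p : (unitInterval × unitInterval) × (unitInterval × unitInterval) =>
        U (f p.1) (f p.2)) (μ.prod μ) := by
    intro U f hf
    obtain ⟨C, hC⟩ := U.bounded'
    have hm : AEMeasurable (fun p : (unitInterval × unitInterval) × (unitInterval × unitInterval) =>
        U (f p.1) (f p.2)) (μ.prod μ) :=
      U.aemeasurable'.comp_quasiMeasurePreserving (hf.prod hf).quasiMeasurePreserving
    exact Integrable.of_bound hm.aestronglyMeasurable C (.of_forall fun p => hC _ _)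
  exact (key W _ h1).sub (key W' _ h2)

end Graphon

/-! ### Measure-theoretic preliminaries -/

/-! Zero cut distance forces equal densities by the counting lemma. Overlay `W` and `W'` by a
coupling `μ`, so that both densities become integrals over independent `μ`-distributed points, and
exchange `W` for `W'` one edge at a time. When the edge `ij` is exchanged, freeze all points except
those at `i` and `j`. No other edge contains both vertices, so the remaining factors split as
`f(z_i) g(z_j)`, and the cut norm controls such bilinear integrals
(`abs_integral_prod_mul_le_of_cut`).

For the converse, scale to `|W|, |W'| ≤ 1`. Sample `n` points and put independent random signs on
the pairs, with means `W(x_i, x_j)`. The probability of a sign pattern is a linear combination of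
densities, so `W` and `W'` give the same law on patterns (`integral_signWeight_congr`). Patterns
that come from no typical sample of `W` have probability below `1/2`, and likewise for `W'`. Hence
one pattern `G` is typical for a sample `x` of `W` and also for a sample `y` of `W'`.

Both sampled matrices are now close to `G` in the cut norm, so they are close to each other with the
index `i` matching `x_i` to `y_i`. Replace `W` and `W'` by step functions on one fixed grid, close
in `L¹`. Only the empirical distribution of the pairs of cells of `(x_i, y_i)` then matters. It is a
finite matrix with nearly the right marginals. It can be corrected to exact marginals and spread out
to a coupling of Lebesgue measure (`exists_matrix_with_marginals`, `exists_coupling_of_matrix`). The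
grid is fixed before `n` grows, so Chebyshev bounds suffice and no regularity lemma is needed. -/

theorem measurePreserving_update_pi {ι Ω : Type*} [Fintype ι] [DecidableEq ι] [MeasurableSpace Ω]
    (μ : Measure Ω) [IsProbabilityMeasure μ] (i : ι) :
    MeasurePreserving (fun q : (ι → Ω) × Ω => Function.update q.1 i q.2)
      ((Measure.pi fun _ => μ).prod μ) (Measure.pi fun _ => μ) := by
  refine ⟨measurable_update', (Measure.pi_eq fun s hs => ?_).symm⟩
  rw [Measure.map_apply measurable_update' (MeasurableSet.univ_pi hs)]
  have : (fun q : (ι → Ω) × Ω => Function.update q.1 i q.2) ⁻¹' (Set.univ.pi s)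
      = (Set.univ.pi (Function.update s i Set.univ)) ×ˢ s i := by
    ext ⟨z, p⟩
    simp only [Set.mem_preimage, Set.mem_pi, Set.mem_univ, true_implies, Set.mem_prod]
    constructor
    · intro h
      refine ⟨fun j => ?_, by simpa using h i⟩
      by_cases hj : j = i
      · subst hj; simp
      · simpa [hj] using h j
    · rintro ⟨h, hp⟩ j
      by_cases hj : j = i
      · subst hj; simpa using hp
      · simpa [hj] using h j
  rw [this, Measure.prod_prod, Measure.pi_pi, ← Finset.mul_prod_erase _ _ (Finset.mem_univ i),
    ← Finset.mul_prod_erase _ (fun j => μ (s j)) (Finset.mem_univ i)]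
  simp only [Function.update_self, measure_univ, one_mul]
  rw [mul_comm]
  congr 1
  refine Finset.prod_congr rfl fun j hj => ?_
  rw [Function.update_of_ne (Finset.ne_of_mem_erase hj)]

theorem measurePreserving_eval_pair {ι Ω : Type*} [Fintype ι] [MeasurableSpace Ω]
    (μ : Measure Ω) [IsProbabilityMeasure μ] {i j : ι} (hij : i ≠ j) :
    MeasurePreserving (fun x : ι → Ω => (x i, x j)) (Measure.pi fun _ => μ) (μ.prod μ) := by
  classical
  have hind := (ProbabilityTheory.iIndepFun_pi (μ := fun _ : ι => μ)
    (X := fun _ x => x) (fun _ => aemeasurable_id)).indepFun hij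
  have := (ProbabilityTheory.indepFun_iff_map_prod_eq_prod_map_map
    (measurable_pi_apply i).aemeasurable (measurable_pi_apply j).aemeasurable).1 hind
  refine ⟨by fun_prop, ?_⟩
  rw [this, (measurePreserving_eval (fun _ : ι => μ) i).map_eq,
    (measurePreserving_eval (fun _ : ι => μ) j).map_eq]

theorem abs_prod_le_pow_card {α : Type*} (s : Finset α) {f : α → ℝ} {M : ℝ}
    (hf : ∀ x ∈ s, |f x| ≤ M) : |∏ x ∈ s, f x| ≤ M ^ s.card := by
  rw [Finset.abs_prod, ← Finset.prod_const]
  exact Finset.prod_le_prod (fun x _ => abs_nonneg _) hf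

/-! ### From indicator functions to bounded functions in the cut norm -/

/-- Testing on the sets where `h ≥ 0` and where `h ≤ 0` bounds the `L¹` norm of `h` by `2 * ε`. -/
theorem abs_integral_mul_le_of_setIntegral {Ω : Type*} [MeasurableSpace Ω] {μ : Measure Ω}
    {f h : Ω → ℝ} {a ε : ℝ} (ha : 0 ≤ a) (hf : ∀ x, |f x| ≤ a) (hh : Measurable h)
    (hi : Integrable h μ) (hS : ∀ S, MeasurableSet S → |∫ x in S, h x ∂μ| ≤ ε) :
    |∫ x, f x * h x ∂μ| ≤ a * (2 * ε) := by
  have h1 : |∫ x, f x * h x ∂μ| ≤ ∫ x, a * |h x| ∂μ := by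
    refine (abs_integral_le_integral_abs).trans ?_
    refine integral_mono_of_nonneg (.of_forall fun x => abs_nonneg _) (hi.abs.const_mul a)
      (.of_forall fun x => ?_)
    simp only [abs_mul]
    exact mul_le_mul_of_nonneg_right (hf x) (abs_nonneg _)
  refine h1.trans ?_
  rw [integral_const_mul]
  refine mul_le_mul_of_nonneg_left ?_ ha
  have h2 := integral_norm_eq_pos_sub_neg hi
  simp only [Real.norm_eq_abs] at h2
  have m1 : MeasurableSet {x | 0 ≤ h x} := measurableSet_le measurable_const hh
  have m2 : MeasurableSet {x | h x ≤ 0} := measurableSet_le hh measurable_const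
  have := abs_le.1 (hS _ m1)
  have := abs_le.1 (hS _ m2)
  rw [h2]
  linarith

/-- The one-variable bound is applied twice, first to `g` with a set `S` in the other variable, then
to `f`. Each application costs a factor `2`. -/
theorem abs_integral_bilinear_le_of_cut {Ω : Type*} [MeasurableSpace Ω] {μ : Measure Ω}
    [IsProbabilityMeasure μ] {f g : Ω → ℝ} {D : Ω × Ω → ℝ} {a b B ε : ℝ}
    (hg : Measurable g) (hD : Measurable D) (hfa : ∀ x, |f x| ≤ a)
    (hgb : ∀ x, |g x| ≤ b) (hDB : ∀ p, |D p| ≤ B)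
    (hS : ∀ S T, MeasurableSet S → MeasurableSet T → |∫ p in S ×ˢ T, D p ∂(μ.prod μ)| ≤ ε) :
    |∫ p, ∫ q, f p * g q * D (p, q) ∂μ ∂μ| ≤ a * b * (4 * ε) := by
  obtain ⟨ω⟩ := μ.nonempty_of_neZero
  have ha : 0 ≤ a := (abs_nonneg _).trans (hfa ω)
  have hb : 0 ≤ b := (abs_nonneg _).trans (hgb ω)
  have hDi : ∀ ν ν' : Measure Ω, [IsFiniteMeasure ν] → [IsFiniteMeasure ν'] →
      Integrable D (ν.prod ν') := fun ν ν' _ _ =>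
    Integrable.of_bound hD.aestronglyMeasurable B (.of_forall hDB)
  have hgDi : ∀ ν ν' : Measure Ω, [IsFiniteMeasure ν] → [IsFiniteMeasure ν'] →
      Integrable (fun p : Ω × Ω => g p.2 * D p) (ν.prod ν') := fun ν ν' _ _ => by
    refine Integrable.of_bound (by fun_prop) (b * B) (.of_forall fun p => ?_)
    rw [Real.norm_eq_abs, abs_mul]
    exact mul_le_mul (hgb _) (hDB _) (abs_nonneg _) hb
  have hk : ∀ S, MeasurableSet S →
      |∫ q, g q * ∫ p in S, D (p, q) ∂μ ∂μ| ≤ b * (2 * ε) := by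
    intro S hSm
    refine abs_integral_mul_le_of_setIntegral hb hgb ?_ (hDi (μ.restrict S) μ).integral_prod_right ?_
    · exact (hD.stronglyMeasurable.integral_prod_left' (μ := μ.restrict S)).measurable
    · intro T hT
      rw [← integral_prod_symm _ (hDi (μ.restrict S) (μ.restrict T)), Measure.prod_restrict]
      exact hS S T hSm hT
  have key : |∫ p, f p * ∫ q, g q * D (p, q) ∂μ ∂μ| ≤ a * (2 * (b * (2 * ε))) := by
    refine abs_integral_mul_le_of_setIntegral ha hfa ?_ (hgDi μ μ).integral_prod_left ?_
    · exact (Measurable.stronglyMeasurable (by fun_prop :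
        Measurable fun p : Ω × Ω => g p.2 * D p)).integral_prod_right.measurable
    · intro S hSm
      rw [← integral_prod _ (hgDi (μ.restrict S) μ), integral_prod_symm _ (hgDi (μ.restrict S) μ)]
      simp only [integral_const_mul]
      exact hk S hSm
  calc _ = |∫ p, f p * ∫ q, g q * D (p, q) ∂μ ∂μ| := by
        simp only [mul_assoc, integral_const_mul]
    _ ≤ _ := key
    _ = _ := by ring

/-! ### Counting lemma -/

/-- One exchange step of the counting lemma: `D` sits on the edge `ij`, and the other edges split
into a factor free of `z j` and a factor free of `z i`. -/
theorem abs_integral_prod_mul_le_of_cut {V Ω : Type*} [Fintype V] [MeasurableSpace Ω]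
    {μ : Measure Ω} [IsProbabilityMeasure μ] {R : Finset (Sym2 V)} {K : Sym2 V → Sym2 Ω → ℝ}
    {D : Ω × Ω → ℝ} {M B ε : ℝ}
    (hK : ∀ e, Measurable fun p : Ω × Ω => K e s(p.1, p.2)) (hKM : ∀ e p, |K e p| ≤ M)
    (hD : Measurable D) (hDB : ∀ p, |D p| ≤ B)
    (hS : ∀ S T, MeasurableSet S → MeasurableSet T → |∫ p in S ×ˢ T, D p ∂(μ.prod μ)| ≤ ε)
    {i j : V} (hij : i ≠ j) (hR : s(i, j) ∉ R) :
    |∫ z : V → Ω, (∏ e ∈ R, K e (e.map z)) * D (z i, z j) ∂(Measure.pi fun _ => μ)|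
      ≤ M ^ R.card * (4 * ε) := by
  classical
  have hKz : ∀ e, Measurable fun z : V → Ω => K e (e.map z) := by
    intro e
    induction e with | _ k l =>
    exact (hK s(k, l)).comp (by fun_prop : Measurable fun z : V → Ω => (z k, z l))
  -- `P` collects the edges avoiding `j`. `Q` collects those containing `j`, which cannot contain
  -- `i` as well because `s(i, j) ∉ R`.
  set P : (V → Ω) → ℝ := fun z => ∏ e ∈ R with j ∉ e, K e (e.map z) with hP
  set Q : (V → Ω) → ℝ := fun z => ∏ e ∈ R with ¬ j ∉ e, K e (e.map z) with hQ
  have hPQ : ∀ z, ∏ e ∈ R, K e (e.map z) = P z * Q z := fun z =>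
    (Finset.prod_filter_mul_prod_filter_not R (fun e => j ∉ e) _).symm
  have hPb : ∀ z, |P z| ≤ M ^ (R.filter fun e => j ∉ e).card := fun z => by
    exact abs_prod_le_pow_card _ fun e _ => hKM _ _
  have hQb : ∀ z, |Q z| ≤ M ^ (R.filter fun e => ¬ j ∉ e).card := fun z => by
    exact abs_prod_le_pow_card _ fun e _ => hKM _ _
  have hmap : ∀ (e : Sym2 V) (k : V) (z : V → Ω) (p : Ω), k ∉ e →
      e.map (Function.update z k p) = e.map z := fun e k z p hk =>
    Sym2.map_congr fun x hx => Function.update_of_ne (by rintro rfl; exact hk hx) _ _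
  have hPj : ∀ z q, P (Function.update z j q) = P z := fun z q =>
    Finset.prod_congr rfl fun e he => by rw [hmap _ _ _ _ (Finset.mem_filter.1 he).2]
  have hQi : ∀ z q, Q (Function.update z i q) = Q z := fun z q => by
    refine Finset.prod_congr rfl fun e he => ?_
    rw [hmap]
    intro hi
    have hj := not_not.1 (Finset.mem_filter.1 he).2
    exact hR ((Sym2.mem_and_mem_iff hij).1 ⟨hi, hj⟩ ▸ (Finset.mem_filter.1 he).1)
  have hPm : Measurable P := Finset.measurable_prod _ fun e _ => hKz e
  have hQm : Measurable Q := Finset.measurable_prod _ fun e _ => hKz e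
  set H : (V → Ω) → ℝ := fun z => (∏ e ∈ R, K e (e.map z)) * D (z i, z j) with hH
  have hHm : Measurable H := by
    refine (Finset.measurable_prod _ fun e _ => hKz e).mul (hD.comp (by fun_prop))
  have hHb : ∀ z, ‖H z‖ ≤ M ^ R.card * B := fun z => by
    rw [Real.norm_eq_abs, hH, abs_mul]
    have hle := abs_prod_le_pow_card R (f := fun e => K e (e.map z)) fun e _ => hKM _ _
    exact mul_le_mul hle (hDB _) (abs_nonneg _) ((abs_nonneg _).trans hle)
  -- Resampling one coordinate preserves the product measure. Doing so at `j` and then at `i` gives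
  -- an inner double integral over these two points with the others frozen.
  have hu := measurePreserving_update_pi (ι := V) μ
  have step : ∀ (k : V) (F : (V → Ω) → ℝ), Measurable F → (∀ z, ‖F z‖ ≤ M ^ R.card * B) →
      ∫ z, F z ∂(Measure.pi fun _ => μ)
        = ∫ z, ∫ p, F (Function.update z k p) ∂μ ∂(Measure.pi fun _ => μ) := by
    intro k F hF hFb
    rw [← integral_prod (fun w : (V → Ω) × Ω => F (Function.update w.1 k w.2))]
    · conv_lhs => rw [← (hu k).map_eq]
      rw [integral_map (hu k).aemeasurable hF.aestronglyMeasurable]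
    · exact Integrable.of_bound (hF.comp (hu k).measurable).aestronglyMeasurable _
        (.of_forall fun _ => hFb _)
  have hfin : ∀ z, |∫ p, ∫ q, H (Function.update (Function.update z i p) j q) ∂μ ∂μ|
      ≤ M ^ R.card * (4 * ε) := by
    intro z
    have := abs_integral_bilinear_le_of_cut (μ := μ) (f := fun p => P (Function.update z i p))
      (g := fun q => Q (Function.update z j q)) (hQm.comp (measurable_update z)) hD
      (fun p => hPb _) (fun q => hQb _) hDB hS
    rw [← pow_add, Finset.card_filter_add_card_filter_not] at this
    refine (congrArg abs ?_).trans_le this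
    refine integral_congr_ae (.of_forall fun p => integral_congr_ae (.of_forall fun q => ?_))
    simp only [hH, hPQ]
    rw [hPj, Function.update_comm hij, hQi]
    simp [Function.update_of_ne hij.symm]
  have hm2 : Measurable fun w : (V → Ω) × Ω => H (Function.update w.1 j w.2) :=
    hHm.comp (hu j).measurable
  rw [step j H hHm hHb, step i]
  · refine (norm_integral_le_of_norm_le_const
      (.of_forall fun z => (Real.norm_eq_abs _).trans_le (hfin z))).trans_eq ?_
    simp
  · exact hm2.stronglyMeasurable.integral_prod_right'.measurable
  · intro z
    refine (norm_integral_le_of_norm_le_const (.of_forall fun q => hHb _)).trans_eq ?_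
    simp

/-! ### Borel representatives, the counting lemma for graphons, and the forward direction. -/

namespace Graphon

theorem measurable_comp_eval {V Ω : Type*} [MeasurableSpace Ω] {W : Graphon}
    (hW : Measurable (Function.uncurry W)) {f : Ω → unitInterval} (hf : Measurable f)
    (p q : V) : Measurable fun z : V → Ω => W (f (z p)) (f (z q)) :=
  hW.comp (by fun_prop : Measurable fun z : V → Ω => (f (z p), f (z q)))

/-- Every graphon agrees almost everywhere with a Borel measurable one. -/
theorem exists_measurable_ae_eq (W : Graphon) :
    ∃ W₀ : Graphon, Measurable (Function.uncurry W₀) ∧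
      Function.uncurry W =ᵐ[volume] Function.uncurry W₀ := by
  obtain ⟨C, hC⟩ := W.bounded'
  have hC0 : 0 ≤ C := (abs_nonneg _).trans (hC 0 0)
  obtain ⟨f, hf, hWf⟩ := W.aemeasurable'
  have hsw : Measure.QuasiMeasurePreserving (Prod.swap : unitInterval × unitInterval → _)
      volume volume :=
    (Measure.measurePreserving_swap (μ := (volume : Measure unitInterval))
      (ν := (volume : Measure unitInterval))).quasiMeasurePreserving
  -- A Borel representative need be neither symmetric nor bounded, so it is symmetrised and
  -- truncated to `[-C, C]`. Both operations fix `W` almost everywhere.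
  have hm : Measurable fun p : unitInterval × unitInterval =>
      max (-C) (min C ((f p + f p.swap) / 2)) := by fun_prop
  refine ⟨⟨fun x y => max (-C) (min C ((f (x, y) + f (y, x)) / 2)), fun x y => by rw [add_comm],
    ⟨C, fun x y => abs_le.2 ⟨le_max_left _ _, max_le (by linarith) (min_le_left _ _)⟩⟩,
    hm.aemeasurable⟩, hm, ?_⟩
  filter_upwards [hWf, hsw.ae_eq_comp hWf] with p h1 h2
  have h3 : W p.2 p.1 = f (p.2, p.1) := h2
  have h4 : W p.1 p.2 = f (p.1, p.2) := h1
  have h5 := abs_le.1 (hC p.1 p.2)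
  change W p.1 p.2 = max (-C) (min C ((f (p.1, p.2) + f (p.2, p.1)) / 2))
  rw [← h3, ← h4, W.symm' p.2 p.1, add_self_div_two, min_eq_right h5.2, max_eq_right h5.1]

/-- The density of a finite set of pairs in a graphon. -/
noncomputable def pairDensity {V : Type*} [Fintype V] (E : Finset (Sym2 V)) (W : Graphon) : ℝ :=
  ∫ x : V → unitInterval, ∏ e ∈ E, W.onSym2 (e.map x)

/-- Loops must be excluded because the diagonal is a null set, on which almost everywhere equality
says nothing. -/
theorem pairDensity_congr_ae {V : Type*} [Fintype V] {E : Finset (Sym2 V)}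
    (hE : ∀ e ∈ E, ¬ e.IsDiag) {W W₀ : Graphon}
    (h : Function.uncurry W =ᵐ[volume] Function.uncurry W₀) :
    pairDensity E W = pairDensity E W₀ := by
  refine integral_congr_ae ?_
  have : ∀ e ∈ E, ∀ᵐ x : V → unitInterval, W.onSym2 (e.map x) = W₀.onSym2 (e.map x) := by
    intro e he
    induction e with | _ i j =>
    exact (measurePreserving_eval_pair volume (mt Sym2.mk_isDiag_iff.2 (hE _ he)) :
      MeasurePreserving (fun x : V → unitInterval => (x i, x j))).quasiMeasurePreserving.ae_eq_comp h
  filter_upwards [(Finset.eventually_all E).2 this] with x hx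
  exact Finset.prod_congr rfl hx

theorem overlayIntegral_congr_ae {W W₀ W' W₀' : Graphon}
    (h : Function.uncurry W =ᵐ[volume] Function.uncurry W₀)
    (h' : Function.uncurry W' =ᵐ[volume] Function.uncurry W₀')
    {μ : Measure (unitInterval × unitInterval)} (hμ : μ ∈ couplings)
    (S T : Set (unitInterval × unitInterval)) :
    overlayIntegral W W' μ S T = overlayIntegral W₀ W₀' μ S T := by
  have := hμ.1
  have h1 : MeasurePreserving Prod.fst μ volume := ⟨measurable_fst, hμ.2.1⟩
  have h2 : MeasurePreserving Prod.snd μ volume := ⟨measurable_snd, hμ.2.2⟩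
  refine integral_congr_ae (ae_restrict_of_ae ?_)
  filter_upwards [(h1.prod h1).quasiMeasurePreserving.ae_eq_comp h,
    (h2.prod h2).quasiMeasurePreserving.ae_eq_comp h'] with p hp hp'
  exact congrArg₂ (· - ·) hp hp'

theorem abs_pairDensity_sub_le {V : Type*} [Fintype V] {E : Finset (Sym2 V)}
    (hE : ∀ e ∈ E, ¬ e.IsDiag) {W W' : Graphon} (hW : Measurable (Function.uncurry W))
    (hW' : Measurable (Function.uncurry W')) {M ε : ℝ} (hM : ∀ x y, |W x y| ≤ M)
    (hM' : ∀ x y, |W' x y| ≤ M) (hM1 : 1 ≤ M) (hε : 0 ≤ ε)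
    {μ : Measure (unitInterval × unitInterval)} (hμ : μ ∈ couplings)
    (hS : ∀ S T, MeasurableSet S → MeasurableSet T → |overlayIntegral W W' μ S T| ≤ ε) :
    |pairDensity E W - pairDensity E W'| ≤ E.card * (M ^ E.card * (4 * ε)) := by
  classical
  have := hμ.1
  have h1 : MeasurePreserving Prod.fst μ volume := ⟨measurable_fst, hμ.2.1⟩
  have h2 : MeasurePreserving Prod.snd μ volume := ⟨measurable_snd, hμ.2.2⟩
  -- Hybrid kernel: edges in `S` carry `W` on first coordinates, the others carry `W'` on second
  -- coordinates. Enlarging `S` from `∅` to `E` telescopes the difference.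
  let K : Finset (Sym2 V) → Sym2 V → Sym2 (unitInterval × unitInterval) → ℝ := fun S e p =>
    if e ∈ S then W.onSym2 (p.map Prod.fst) else W'.onSym2 (p.map Prod.snd)
  have hK : ∀ S e, Measurable fun p : (unitInterval × unitInterval) × (unitInterval × unitInterval)
      => K S e s(p.1, p.2) := by
    intro S e
    by_cases he : e ∈ S
    · simp only [K, if_pos he]
      exact hW.comp (by fun_prop : Measurable fun p : (unitInterval × unitInterval) ×
        (unitInterval × unitInterval) => (p.1.1, p.2.1))
    · simp only [K, if_neg he]
      exact hW'.comp (by fun_prop : Measurable fun p : (unitInterval × unitInterval) ×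
        (unitInterval × unitInterval) => (p.1.2, p.2.2))
  have hKM : ∀ S e p, |K S e p| ≤ M := by
    intro S e p
    induction p with | _ p q =>
    by_cases he : e ∈ S
    · simp only [K, if_pos he]; exact hM _ _
    · simp only [K, if_neg he]; exact hM' _ _
  have hKz : ∀ S e, Measurable fun z : V → unitInterval × unitInterval => K S e (e.map z) := by
    intro S e
    induction e with | _ k l =>
    exact (hK S s(k, l)).comp
      (by fun_prop : Measurable fun z : V → unitInterval × unitInterval => (z k, z l))
  let T : Finset (Sym2 V) → ℝ := fun S =>
    ∫ z, ∏ e ∈ E, K S e (e.map z) ∂(Measure.pi fun _ : V => μ)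
  have hTW : T E = pairDensity E W := by
    have hp := measurePreserving_pi (fun _ : V => μ) (fun _ : V => (volume : Measure unitInterval))
      (fun _ => h1)
    rw [pairDensity, volume_pi, ← hp.map_eq, integral_map hp.aemeasurable]
    · refine integral_congr_ae (.of_forall fun z => Finset.prod_congr rfl fun e he => ?_)
      simp only [K, if_pos he, Sym2.map_map]
      rfl
    · refine (Finset.measurable_prod _ fun e _ => ?_).aestronglyMeasurable
      induction e with | _ k l => exact measurable_comp_eval hW measurable_id k l
  have hTW' : T ∅ = pairDensity E W' := by
    have hp := measurePreserving_pi (fun _ : V => μ) (fun _ : V => (volume : Measure unitInterval))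
      (fun _ => h2)
    rw [pairDensity, volume_pi, ← hp.map_eq, integral_map hp.aemeasurable]
    · refine integral_congr_ae (.of_forall fun z => Finset.prod_congr rfl fun e he => ?_)
      simp only [K, if_neg (Finset.notMem_empty e), Sym2.map_map]
      rfl
    · refine (Finset.measurable_prod _ fun e _ => ?_).aestronglyMeasurable
      induction e with | _ k l => exact measurable_comp_eval hW' measurable_id k l
  have hint : ∀ S, Integrable (fun z => ∏ e ∈ E, K S e (e.map z)) (Measure.pi fun _ : V => μ) :=
    fun S => Integrable.of_bound (Finset.measurable_prod _ fun e _ => hKz S e).aestronglyMeasurable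
      (M ^ E.card) (.of_forall fun z => abs_prod_le_pow_card _ fun e _ => hKM _ _ _)
  have key : ∀ S ⊆ E, |T S - T ∅| ≤ S.card * (M ^ E.card * (4 * ε)) := by
    intro S
    induction S using Finset.induction_on with
    | empty => simp
    | insert e S heS ih =>
      intro hSE
      have he : e ∈ E := hSE (Finset.mem_insert_self _ _)
      have hstep : |T (insert e S) - T S| ≤ M ^ E.card * (4 * ε) := by
        rw [← integral_sub (hint _) (hint _)]
        have heq : ∀ z : V → unitInterval × unitInterval,
            (∏ e' ∈ E, K (insert e S) e' (e'.map z)) - ∏ e' ∈ E, K S e' (e'.map z)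
            = (∏ e' ∈ E.erase e, K S e' (e'.map z))
              * (W.onSym2 ((e.map z).map Prod.fst) - W'.onSym2 ((e.map z).map Prod.snd)) := by
          intro z
          rw [← Finset.mul_prod_erase E _ he, ← Finset.mul_prod_erase E _ he]
          have : ∏ e' ∈ E.erase e, K (insert e S) e' (e'.map z)
              = ∏ e' ∈ E.erase e, K S e' (e'.map z) :=
            Finset.prod_congr rfl fun e' he' => by
              simp only [K, Finset.mem_insert, Finset.ne_of_mem_erase he', false_or]
          rw [this]
          simp only [K, Finset.mem_insert_self, if_true, if_neg heS]
          ring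
        simp only [heq]
        have hcard : (E.erase e).card ≤ E.card := Finset.card_le_card (Finset.erase_subset _ _)
        have hnot : e ∉ E.erase e := Finset.notMem_erase e E
        have hd := hE e he
        clear heq
        generalize E.erase e = R at *
        induction e with | _ i j =>
        refine (abs_integral_prod_mul_le_of_cut (K := K S) (M := M) (B := M + M) (ε := ε)
          (D := fun p => W p.1.1 p.2.1 - W' p.1.2 p.2.2) (hK S) (hKM S) ?_ ?_ ?_
          (mt Sym2.mk_isDiag_iff.2 hd) hnot).trans ?_
        · exact (hW.comp (by fun_prop : Measurable fun p : (unitInterval × unitInterval) ×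
            (unitInterval × unitInterval) => (p.1.1, p.2.1))).sub
            (hW'.comp (by fun_prop : Measurable fun p : (unitInterval × unitInterval) ×
            (unitInterval × unitInterval) => (p.1.2, p.2.2)))
        · exact fun p => (abs_sub _ _).trans (add_le_add (hM _ _) (hM' _ _))
        · exact hS
        · gcongr
      have := ih ((Finset.subset_insert _ _).trans hSE)
      rw [Finset.card_insert_of_notMem heS]
      push_cast
      have h3 := abs_sub_le (T (insert e S)) (T S) (T ∅)
      linarith
  rw [← hTW, ← hTW']
  exact key E subset_rfl

theorem homDensity_eq_of_cutDist_eq_zero {V : Type*} [Fintype V] {W W' : Graphon}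
    (h : cutDist W W' = 0) (F : SimpleGraph V) : homDensity F W = homDensity F W' := by
  classical
  obtain ⟨W₀, hW₀, hWW₀⟩ := W.exists_measurable_ae_eq
  obtain ⟨W₀', hW₀', hWW₀'⟩ := W'.exists_measurable_ae_eq
  have hF : ∀ e ∈ F.edgeFinset, ¬ e.IsDiag := fun e he =>
    F.not_isDiag_of_mem_edgeFinset he
  obtain ⟨C, hC⟩ := W₀.bounded'
  obtain ⟨C', hC'⟩ := W₀'.bounded'
  set M := max 1 (max C C') with hM
  have key : ∀ ε : ℝ, 0 < ε → |pairDensity F.edgeFinset W₀ - pairDensity F.edgeFinset W₀'|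
      ≤ F.edgeFinset.card * (M ^ F.edgeFinset.card * (4 * ε)) := by
    intro ε hε
    have : Nonempty couplings := nonempty_couplings.to_subtype
    obtain ⟨⟨μ, hμ⟩, hlt⟩ := exists_lt_of_ciInf_lt (show cutDist W W' < ε by rwa [h])
    refine abs_pairDensity_sub_le hF hW₀ hW₀'
      (fun x y => (hC x y).trans ((le_max_left _ _).trans (le_max_right _ _)))
      (fun x y => (hC' x y).trans ((le_max_right _ _).trans (le_max_right _ _)))
      (le_max_left _ _) hε.le hμ fun S T hS hT => ?_
    rw [← overlayIntegral_congr_ae hWW₀ hWW₀' hμ]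
    exact (le_ciSup (bddAbove_overlayIntegral W W' hμ) (⟨S, hS⟩, ⟨T, hT⟩)).trans hlt.le
  have heq : pairDensity F.edgeFinset W₀ = pairDensity F.edgeFinset W₀' := by
    by_contra hne
    have hpos := abs_pos.2 (sub_ne_zero.2 hne)
    set A : ℝ := F.edgeFinset.card * (M ^ F.edgeFinset.card * 4) with hA
    have hA0 : 0 ≤ A := by positivity
    -- With this `ε` the bound reads `d ≤ A * d / (A + 1)`, which is impossible for `d > 0`.
    have h1 := key (|pairDensity F.edgeFinset W₀ - pairDensity F.edgeFinset W₀'| / (A + 1))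
      (by positivity)
    generalize |pairDensity F.edgeFinset W₀ - pairDensity F.edgeFinset W₀'| = d at *
    have h2 : d ≤ A * (d / (A + 1)) := by rw [hA] at h1 ⊢; linarith
    rw [← mul_div_assoc, le_div_iff₀ (by positivity)] at h2
    linarith
  change pairDensity _ W = pairDensity _ W'
  convert (pairDensity_congr_ae hF hWW₀).trans (heq.trans (pairDensity_congr_ae hF hWW₀').symm)

end Graphon

/-! ### Random signs with prescribed means -/

/-- The sign `±1` encoded by a Boolean. -/
def boolSign (b : Bool) : ℝ := if b then 1 else -1

theorem abs_boolSign (b : Bool) : |boolSign b| = 1 := by cases b <;> simp [boolSign]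

/-- The probability of the sign pattern `G` when the signs are independent with means `w`. -/
noncomputable def signWeight {ι : Type*} [Fintype ι] (w : ι → ℝ) (G : ι → Bool) : ℝ :=
  ∏ e, (1 + boolSign (G e) * w e) / 2

section signWeight

variable {ι : Type*} {w : ι → ℝ}

theorem boolSign_mul_mem (hw : ∀ e, |w e| ≤ 1) (b : Bool) (e : ι) :
    0 ≤ (1 + boolSign b * w e) / 2 ∧ (1 + boolSign b * w e) / 2 ≤ 1 := by
  have := abs_le.1 (hw e)
  cases b <;> simp [boolSign] <;> constructor <;> linarith

theorem signWeight_nonneg [Fintype ι] (hw : ∀ e, |w e| ≤ 1) (G : ι → Bool) : 0 ≤ signWeight w G :=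
  Finset.prod_nonneg fun e _ => (boolSign_mul_mem hw _ e).1

theorem signWeight_le_one [Fintype ι] (hw : ∀ e, |w e| ≤ 1) (G : ι → Bool) : signWeight w G ≤ 1 :=
  Finset.prod_le_one (fun e _ => (boolSign_mul_mem hw _ e).1)
    fun e _ => (boolSign_mul_mem hw _ e).2

theorem sum_signWeight [Fintype ι] [DecidableEq ι] (w : ι → ℝ) : ∑ G, signWeight w G = 1 := by
  have := Finset.prod_univ_sum (fun _ : ι => (Finset.univ : Finset Bool))
    (fun e b => (1 + boolSign b * w e) / 2)
  rw [Fintype.piFinset_univ] at this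
  unfold signWeight
  rw [← this]
  refine Finset.prod_eq_one fun e _ => ?_
  simp [boolSign]
  ring

/-- Flipping the sign at `e` cancels terms in pairs, since `(1 + w e) * (1 - w e)` appears once with
each sign. Probabilistically, a centred sign is orthogonal to every function of the other signs. -/
theorem sum_signWeight_mul_eq_zero [Fintype ι] [DecidableEq ι] (w : ι → ℝ) (e : ι)
    {F : (ι → Bool) → ℝ} (hF : ∀ G b, F (Function.update G e b) = F G) :
    ∑ G, signWeight w G * ((boolSign (G e) - w e) * F G) = 0 := by
  have hinv : Function.Involutive fun G : ι → Bool => Function.update G e (!G e) := by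
    intro G; simp
  set g : (ι → Bool) → ℝ := fun G => signWeight w G * ((boolSign (G e) - w e) * F G) with hg
  have h1 : ∑ G, g (Function.update G e (!G e)) = ∑ G, g G :=
    Equiv.sum_comp hinv.toPerm g
  have h2 : ∀ G, g G + g (Function.update G e (!G e)) = 0 := by
    intro G
    simp only [hg, hF, signWeight]
    rw [← Finset.mul_prod_erase _ _ (Finset.mem_univ e),
      ← Finset.mul_prod_erase _ (fun e' => (1 + boolSign (Function.update G e (!G e) e') * w e') / 2)
        (Finset.mem_univ e)]
    have : ∏ e' ∈ Finset.univ.erase e, (1 + boolSign (Function.update G e (!G e) e') * w e') / 2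
        = ∏ e' ∈ Finset.univ.erase e, (1 + boolSign (G e') * w e') / 2 :=
      Finset.prod_congr rfl fun e' he' => by
        rw [Function.update_of_ne (Finset.ne_of_mem_erase he')]
    rw [this, Function.update_self]
    cases G e <;> simp [boolSign] <;> ring
  have h3 : ∑ G, (g G + g (Function.update G e (!G e))) = 0 :=
    Finset.sum_eq_zero fun G _ => h2 G
  rw [Finset.sum_add_distrib, h1] at h3
  linarith

/-- Expanding the product into multilinear monomials in `w`; their integrals over the sample points
are densities. -/
theorem signWeight_eq_sum [Fintype ι] [DecidableEq ι] (w : ι → ℝ) (G : ι → Bool) :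
    signWeight w G = ∑ S : Finset ι,
      ((1 / 2) ^ Fintype.card ι * ∏ e ∈ S, boolSign (G e)) * ∏ e ∈ S, w e := by
  have h1 : signWeight w G = (1 / 2) ^ Fintype.card ι * ∏ e, (1 + boolSign (G e) * w e) := by
    unfold signWeight
    simp only [div_eq_mul_inv, Finset.prod_mul_distrib]
    simp [mul_comm]
  rw [h1, Finset.prod_one_add, Finset.mul_sum, Finset.powerset_univ]
  refine Finset.sum_congr rfl fun S _ => ?_
  rw [Finset.prod_mul_distrib, mul_assoc]

end signWeight

/-! ### Cut norm of the centred sign matrix, through codegrees. -/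

section deviation

variable {V : Type*}

/-- The centred sign matrix. -/
noncomputable def signDev [DecidableEq V] (w : Sym2 V → ℝ) (G : Sym2 V → Bool) (i j : V) : ℝ :=
  if i = j then 0 else boolSign (G s(i, j)) - w s(i, j)

theorem abs_signDev_le [DecidableEq V] {w : Sym2 V → ℝ} (hw : ∀ e, |w e| ≤ 1) (G : Sym2 V → Bool)
    (i j : V) : |signDev w G i j| ≤ 2 := by
  unfold signDev
  split_ifs
  · simp
  · refine (abs_sub _ _).trans ?_
    have := hw s(i, j)
    rw [abs_boolSign]
    linarith

/-- Unless a factor is a vanishing diagonal entry, the pair `ij` occurs only once in the 4-cycle, so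
its centred sign averages to zero. -/
theorem sum_signWeight_cycle_eq_zero [Fintype V] [DecidableEq V] (w : Sym2 V → ℝ)
    {i j k l : V} (hil : i ≠ l) (hjk : j ≠ k) :
    ∑ G, signWeight w G *
      (signDev w G i j * signDev w G i k * (signDev w G l j * signDev w G l k)) = 0 := by
  by_cases hij : i = j
  · simp [signDev, hij]
  by_cases hlj : l = j
  · simp [signDev, hlj]
  have hF : ∀ (G : Sym2 V → Bool) b (p q : V), s(p, q) ≠ s(i, j) →
      signDev w (Function.update G s(i, j) b) p q = signDev w G p q := by
    intro G b p q h
    simp only [signDev, Function.update_of_ne h]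
  have := sum_signWeight_mul_eq_zero w s(i, j)
    (F := fun G => signDev w G i k * (signDev w G l j * signDev w G l k)) (fun G b => by
      rw [hF _ _ i k, hF _ _ l j, hF _ _ l k]
      · intro h; rcases Sym2.eq_iff.1 h with h | h
        · exact hil h.1.symm
        · exact hlj h.1
      · intro h; rcases Sym2.eq_iff.1 h with h | h
        · exact hil h.1.symm
        · exact hlj h.1
      · intro h; rcases Sym2.eq_iff.1 h with h | h
        · exact hjk h.2.symm
        · exact hij h.1)
  rw [← this]
  refine Finset.sum_congr rfl fun G _ => ?_
  rw [mul_assoc (signDev w G i j)]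
  conv_lhs => rw [show signDev w G i j = boolSign (G s(i, j)) - w s(i, j) from if_neg hij]

/-- The sum of the squared codegrees of a matrix. -/
def codegSq [Fintype V] (A : V → V → ℝ) : ℝ := ∑ j, ∑ k, (∑ i, A i j * A i k) ^ 2

theorem codegSq_nonneg [Fintype V] (A : V → V → ℝ) : 0 ≤ codegSq A :=
  Finset.sum_nonneg fun _ _ => Finset.sum_nonneg fun _ _ => sq_nonneg _

/-- Only quadruples with `j = k` or `i = l` survive. There are at most `2n³` of them, each
contributing at most `2⁴`. -/
theorem sum_signWeight_codegSq_le [Fintype V] [DecidableEq V] {w : Sym2 V → ℝ}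
    (hw : ∀ e, |w e| ≤ 1) : ∑ G, signWeight w G * codegSq (signDev w G) ≤ 32 * (Fintype.card V : ℝ) ^ 3 := by
  have h1 : ∀ G, signWeight w G * codegSq (signDev w G) = ∑ j, ∑ k, ∑ i, ∑ l, signWeight w G *
      (signDev w G i j * signDev w G i k * (signDev w G l j * signDev w G l k)) := by
    intro G
    simp only [codegSq, sq, Finset.sum_mul_sum]
    simp only [Finset.mul_sum]
  have h2 : ∑ G, signWeight w G * codegSq (signDev w G) = ∑ j, ∑ k, ∑ i, ∑ l, ∑ G, signWeight w G *
      (signDev w G i j * signDev w G i k * (signDev w G l j * signDev w G l k)) := by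
    simp only [h1]
    rw [Finset.sum_comm]; refine Finset.sum_congr rfl fun j _ => ?_
    rw [Finset.sum_comm]; refine Finset.sum_congr rfl fun k _ => ?_
    rw [Finset.sum_comm]; refine Finset.sum_congr rfl fun i _ => ?_
    rw [Finset.sum_comm]
  rw [h2]
  have h3 : ∀ i j k l : V, ∑ G, signWeight w G *
      (signDev w G i j * signDev w G i k * (signDev w G l j * signDev w G l k))
      ≤ (if j = k then 16 else 0) + (if i = l then 16 else 0) := by
    intro i j k l
    by_cases hil : i = l ∨ j = k
    · have h16 : ∑ G, signWeight w G *
          (signDev w G i j * signDev w G i k * (signDev w G l j * signDev w G l k)) ≤ 16 := by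
        calc _ ≤ ∑ G, signWeight w G * 16 := by
              refine Finset.sum_le_sum fun G _ =>
                mul_le_mul_of_nonneg_left ?_ (signWeight_nonneg hw G)
              refine (le_abs_self _).trans ?_
              simp only [abs_mul]
              have := abs_signDev_le hw G
              calc _ ≤ (2 * 2 * (2 * 2) : ℝ) := by gcongr <;> exact this _ _
                _ = 16 := by norm_num
          _ = 16 := by rw [← Finset.sum_mul, sum_signWeight, one_mul]
      refine h16.trans ?_
      rcases hil with h | h
      · simp only [h, if_true]; split_ifs <;> norm_num
      · simp only [h, if_true]; split_ifs <;> norm_num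
    · push Not at hil
      rw [sum_signWeight_cycle_eq_zero w hil.1 hil.2]
      split_ifs <;> norm_num
  calc _ ≤ ∑ j : V, ∑ k : V, ∑ i : V, ∑ l : V,
        (((if j = k then 16 else 0) + (if i = l then 16 else 0)) : ℝ) :=
      Finset.sum_le_sum fun j _ => Finset.sum_le_sum fun k _ => Finset.sum_le_sum fun i _ =>
        Finset.sum_le_sum fun l _ => h3 i j k l
    _ = _ := by
      simp [Finset.sum_add_distrib]
      ring

/-- Cauchy–Schwarz twice. Since `codegSq` averages to order `n³`, the bilinear form is typically of
order `n^(7/4)`, below `n²`, simultaneously for all `s` and `t`. -/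
theorem pow_four_sum_le_codegSq [Fintype V] (A : V → V → ℝ) {s t : V → ℝ} (hs : ∀ i, |s i| ≤ 1)
    (ht : ∀ i, |t i| ≤ 1) :
    (∑ i, ∑ j, s i * t j * A i j) ^ 4 ≤ (Fintype.card V : ℝ) ^ 4 * codegSq A := by
  set n : ℝ := (Fintype.card V : ℝ) with hn
  have hsq : ∀ f : V → ℝ, (∀ i, |f i| ≤ 1) → ∑ i, f i ^ 2 ≤ n := by
    intro f hf
    calc ∑ i, f i ^ 2 ≤ ∑ _i : V, (1 : ℝ) :=
          Finset.sum_le_sum fun i _ => (sq_le_one_iff_abs_le_one _).2 (hf i)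
      _ = n := by simp [hn]
  set Q := ∑ j, ∑ k, t j * t k * ∑ i, A i j * A i k with hQ
  have h1 : (∑ i, ∑ j, s i * t j * A i j) ^ 2 ≤ n * Q := by
    have e1 : ∑ i, ∑ j, s i * t j * A i j = ∑ i, s i * ∑ j, t j * A i j := by
      simp only [Finset.mul_sum, mul_assoc]
    have e2 : ∑ i, (∑ j, t j * A i j) ^ 2 = Q := by
      simp only [hQ, sq, Finset.sum_mul_sum]
      simp only [Finset.mul_sum]
      rw [Finset.sum_comm]; refine Finset.sum_congr rfl fun j _ => ?_
      rw [Finset.sum_comm]; refine Finset.sum_congr rfl fun k _ => ?_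
      exact Finset.sum_congr rfl fun i _ => by ring
    rw [e1, ← e2]
    refine (Finset.sum_mul_sq_le_sq_mul_sq _ _ _).trans ?_
    exact mul_le_mul_of_nonneg_right (hsq s hs) (Finset.sum_nonneg fun _ _ => sq_nonneg _)
  have h2 : Q ^ 2 ≤ n ^ 2 * codegSq A := by
    have e1 : Q = ∑ p : V × V, (t p.1 * t p.2) * ∑ i, A i p.1 * A i p.2 := by
      rw [Fintype.sum_prod_type]
    have e2 : codegSq A = ∑ p : V × V, (∑ i, A i p.1 * A i p.2) ^ 2 := by
      rw [Fintype.sum_prod_type]; rfl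
    rw [e1, e2]
    refine (Finset.sum_mul_sq_le_sq_mul_sq _ _ _).trans ?_
    refine mul_le_mul_of_nonneg_right ?_ (Finset.sum_nonneg fun _ _ => sq_nonneg _)
    calc ∑ p : V × V, (t p.1 * t p.2) ^ 2 = (∑ i, t i ^ 2) * ∑ i, t i ^ 2 := by
          rw [Fintype.sum_prod_type, Finset.sum_mul_sum]
          simp only [mul_pow]
      _ ≤ n ^ 2 := by
          rw [sq]
          have h0 : 0 ≤ ∑ i, t i ^ 2 := Finset.sum_nonneg fun _ _ => sq_nonneg _
          exact mul_le_mul (hsq t ht) (hsq t ht) h0 (h0.trans (hsq t ht))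
  calc _ = ((∑ i, ∑ j, s i * t j * A i j) ^ 2) ^ 2 := by ring
    _ ≤ (n * Q) ^ 2 := pow_le_pow_left₀ (sq_nonneg _) h1 2
    _ = n ^ 2 * Q ^ 2 := by ring
    _ ≤ n ^ 2 * (n ^ 2 * codegSq A) := mul_le_mul_of_nonneg_left h2 (sq_nonneg _)
    _ = _ := by ring

end deviation

namespace Graphon

/-! ### The law of the sampled sign pattern. -/

section sampling

variable {V : Type*} [DecidableEq V]

/-- The values of a graphon on the pairs of distinct sample points. -/
def sampleWeight (W : Graphon) (x : V → unitInterval) (e : Sym2 V) : ℝ :=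
  if e.IsDiag then 0 else W.onSym2 (e.map x)

theorem abs_sampleWeight_le {W : Graphon} (hW1 : ∀ x y, |W x y| ≤ 1) (x : V → unitInterval)
    (e : Sym2 V) : |W.sampleWeight x e| ≤ 1 := by
  unfold sampleWeight
  split_ifs
  · simp
  · induction e with | _ i j => exact hW1 _ _

theorem measurable_sampleWeight {W : Graphon} (hW : Measurable (Function.uncurry W))
    (e : Sym2 V) : Measurable fun x : V → unitInterval => W.sampleWeight x e := by
  unfold sampleWeight
  split_ifs
  · exact measurable_const
  · induction e with | _ i j => exact measurable_comp_eval hW measurable_id i j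

variable [Fintype V]

theorem measurable_signWeight_sampleWeight {W : Graphon} (hW : Measurable (Function.uncurry W))
    (G : Sym2 V → Bool) : Measurable fun x => signWeight (W.sampleWeight x) G := by
  unfold signWeight
  exact Finset.measurable_prod _ fun e _ =>
    ((measurable_const.add ((measurable_sampleWeight hW e).const_mul _)).div_const 2)

/-- The zero diagonal of `sampleWeight` kills every monomial with a loop, so only densities of
simple graphs remain. -/
theorem integral_prod_sampleWeight (W : Graphon) (S : Finset (Sym2 V)) :
    ∫ x, ∏ e ∈ S, W.sampleWeight x e
      = if ∃ e ∈ S, e.IsDiag then 0 else pairDensity S W := by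
  split_ifs with h
  · obtain ⟨e, he, hd⟩ := h
    have : ∀ x, ∏ e ∈ S, W.sampleWeight x e = 0 := fun x =>
      Finset.prod_eq_zero he (if_pos hd)
    simp [this]
  · push Not at h
    refine integral_congr_ae (.of_forall fun x => Finset.prod_congr rfl fun e he => ?_)
    exact if_neg (h e he)

theorem integral_signWeight_congr {W W' : Graphon} (hW : Measurable (Function.uncurry W))
    (hW' : Measurable (Function.uncurry W')) (hW1 : ∀ x y, |W x y| ≤ 1)
    (hW1' : ∀ x y, |W' x y| ≤ 1)
    (h : ∀ E : Finset (Sym2 V), (∀ e ∈ E, ¬ e.IsDiag) → pairDensity E W = pairDensity E W')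
    (G : Sym2 V → Bool) :
    ∫ x, signWeight (W.sampleWeight x) G = ∫ x, signWeight (W'.sampleWeight x) G := by
  have key : ∀ U : Graphon, Measurable (Function.uncurry U) → (∀ x y, |U x y| ≤ 1) →
      ∫ x, signWeight (U.sampleWeight x) G = ∑ S : Finset (Sym2 V),
      ((1 / 2) ^ Fintype.card (Sym2 V) * ∏ e ∈ S, boolSign (G e)) *
        if ∃ e ∈ S, e.IsDiag then 0 else pairDensity S U := by
    intro U hU hU1
    simp only [signWeight_eq_sum]
    rw [integral_finsetSum]
    · simp only [integral_const_mul, integral_prod_sampleWeight]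
    · intro S _
      refine Integrable.const_mul (Integrable.of_bound (Finset.measurable_prod _ fun e _ =>
        measurable_sampleWeight hU e).aestronglyMeasurable 1 (.of_forall fun x => ?_)) _
      refine (abs_prod_le_pow_card S fun e _ => abs_sampleWeight_le hU1 x e).trans ?_
      simp
  rw [key W hW hW1, key W' hW' hW1']
  refine Finset.sum_congr rfl fun S _ => ?_
  split_ifs with hS
  · rfl
  · push Not at hS
    rw [h S hS]

end sampling

/-! ### First and second moments of the sampling errors. -/

section concentration

theorem measurable_cellStep {κ : Type*} [Fintype κ] [MeasurableSpace κ]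
    [MeasurableSingletonClass κ] {c : unitInterval → κ} (hc : Measurable c) (U : κ → κ → ℝ) :
    Measurable fun p : unitInterval × unitInterval => U (c p.1) (c p.2) :=
  (measurable_of_countable (fun q : κ × κ => U q.1 q.2)).comp
    (by fun_prop : Measurable fun p : unitInterval × unitInterval => (c p.1, c p.2))

variable {V κ : Type*} [Fintype V] [DecidableEq V]

/-- Off-diagonal `L¹` distance, at the sample points, of a graphon and a step function. -/
noncomputable def sampleL1 (W : Graphon) (c : unitInterval → κ) (U : κ → κ → ℝ)
    (x : V → unitInterval) : ℝ :=
  ∑ i, ∑ j, if i = j then 0 else |W (x i) (x j) - U (c (x i)) (c (x j))|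

/-- Deviation of the number of sample points in a cell from its mean. -/
noncomputable def cellDev [DecidableEq κ] (c : unitInterval → κ) (a : κ) (x : V → unitInterval) : ℝ :=
  ∑ i, ((if c (x i) = a then 1 else 0) - volume.real (c ⁻¹' {a}))

variable [MeasurableSpace κ] [MeasurableSingletonClass κ]

theorem integral_sampleL1_le [Fintype κ] {W : Graphon} (hW : Measurable (Function.uncurry W))
    (hW1 : ∀ x y, |W x y| ≤ 1) {c : unitInterval → κ} (hc : Measurable c) {U : κ → κ → ℝ}
    (hU : ∀ a b, |U a b| ≤ 1) {δ : ℝ} (hδ0 : 0 ≤ δ)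
    (hδ : ∫ p : unitInterval × unitInterval, |W p.1 p.2 - U (c p.1) (c p.2)| ≤ δ) :
    Integrable (fun x : V → unitInterval => W.sampleL1 c U x) ∧
    ∫ x : V → unitInterval, W.sampleL1 c U x ≤ (Fintype.card V : ℝ) ^ 2 * δ := by
  have hm : Measurable fun p : unitInterval × unitInterval => |W p.1 p.2 - U (c p.1) (c p.2)| :=
    (hW.sub (measurable_cellStep hc U)).abs
  have hi : ∀ i j : V, Integrable (fun x : V → unitInterval =>
      if i = j then 0 else |W (x i) (x j) - U (c (x i)) (c (x j))|) := by
    intro i j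
    split_ifs
    · exact integrable_zero _ _ _
    · refine Integrable.of_bound (hm.comp (by fun_prop : Measurable
        fun x : V → unitInterval => (x i, x j))).aestronglyMeasurable (1 + 1)
        (.of_forall fun x => ?_)
      rw [Real.norm_eq_abs, abs_abs]
      exact (abs_sub _ _).trans (add_le_add (hW1 _ _) (hU _ _))
  refine ⟨integrable_finsetSum _ fun i _ => integrable_finsetSum _ fun j _ => hi i j, ?_⟩
  unfold sampleL1
  rw [integral_finsetSum _ fun i _ => integrable_finsetSum _ fun j _ => hi i j]
  simp_rw [integral_finsetSum Finset.univ fun j (_ : j ∈ Finset.univ) => hi _ j]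
  calc _ ≤ ∑ _i : V, ∑ _j : V, δ := by
        refine Finset.sum_le_sum fun i _ => Finset.sum_le_sum fun j _ => ?_
        split_ifs with hij
        · simpa using hδ0
        · refine le_trans (le_of_eq ?_) hδ
          have hp := measurePreserving_eval_pair (volume : Measure unitInterval) hij
          rw [Measure.volume_eq_prod, ← hp.map_eq,
            integral_map hp.aemeasurable hm.aestronglyMeasurable]
          rfl
    _ = _ := by simp; ring

/-- A variance computation: distinct sample points are independent, so the cross terms vanish, and
each diagonal term is at most `1`. -/
theorem integral_cellDev_sq_le [DecidableEq κ] {c : unitInterval → κ} (hc : Measurable c) (a : κ) :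
    Integrable (fun x : V → unitInterval => cellDev c a x ^ 2) ∧
    ∫ x : V → unitInterval, cellDev c a x ^ 2 ≤ Fintype.card V := by
  have hca : MeasurableSet (c ⁻¹' {a}) := hc (measurableSet_singleton a)
  set h : unitInterval → ℝ := fun u => (if c u = a then 1 else 0) - volume.real (c ⁻¹' {a})
    with hh
  have hm : Measurable h :=
    (Measurable.ite hca measurable_const measurable_const).sub measurable_const
  have hb : ∀ u, |h u| ≤ 1 := fun u => by
    have h0 : 0 ≤ volume.real (c ⁻¹' {a}) := measureReal_nonneg
    have h1 : volume.real (c ⁻¹' {a}) ≤ 1 := measureReal_le_one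
    simp only [hh]
    rw [abs_le]
    split_ifs <;> constructor <;> linarith
  have h0 : ∫ u, h u = 0 := by
    have he : (fun u => if c u = a then (1 : ℝ) else 0) = (c ⁻¹' {a}).indicator 1 := by
      funext u
      by_cases hu : c u = a <;> simp [hu]
    rw [hh, integral_sub, he, integral_indicator_one hca, integral_const,
      probReal_univ, one_smul, sub_self]
    · rw [he]; exact (integrable_const 1).indicator hca
    · exact integrable_const _
  have hi : ∀ i j : V, Integrable (fun x : V → unitInterval => h (x i) * h (x j)) := by
    intro i j
    refine Integrable.of_bound (by fun_prop) (1 * 1) (.of_forall fun x => ?_)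
    rw [Real.norm_eq_abs, abs_mul]
    exact mul_le_mul (hb _) (hb _) (abs_nonneg _) zero_le_one
  have hexp : ∀ x : V → unitInterval, cellDev c a x ^ 2 = ∑ i, ∑ j, h (x i) * h (x j) := by
    intro x
    rw [← Finset.sum_mul_sum, ← sq]
    rfl
  simp only [hexp]
  refine ⟨integrable_finsetSum _ fun i _ => integrable_finsetSum _ fun j _ => hi i j, ?_⟩
  rw [integral_finsetSum _ fun i _ => integrable_finsetSum _ fun j _ => hi i j]
  simp_rw [integral_finsetSum Finset.univ fun j (_ : j ∈ Finset.univ) => hi _ j]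
  calc _ ≤ ∑ i : V, ∑ j : V, (if i = j then (1 : ℝ) else 0) := by
        refine Finset.sum_le_sum fun i _ => Finset.sum_le_sum fun j _ => ?_
        split_ifs with hij
        · refine (integral_mono (hi i j) (integrable_const 1) fun x => ?_).trans_eq (by simp)
          refine (le_abs_self _).trans ?_
          rw [abs_mul]
          exact (mul_le_mul (hb _) (hb _) (abs_nonneg _) zero_le_one).trans_eq (one_mul 1)
        · have hp := measurePreserving_eval_pair (volume : Measure unitInterval) hij
          have : ∫ x : V → unitInterval, h (x i) * h (x j)
              = ∫ p, h p.1 * h p.2 ∂((volume : Measure unitInterval).prod volume) := by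
            rw [← hp.map_eq, integral_map hp.aemeasurable (by fun_prop)]
            rfl
          rw [this, integral_prod_mul, h0, zero_mul]
    _ = _ := by simp

end concentration

/-! ### Typical samples and a sign pattern common to both graphons. -/

section typical

variable {κ : Type*} [Fintype κ] [DecidableEq κ]

/-- A sample on which a graphon is close to a step function, the cells have about the right
number of points, and the sign pattern is close to the graphon in the cut norm. -/
structure TypicalSample (W : Graphon) (c : unitInterval → κ) (U : κ → κ → ℝ) (δ η θ : ℝ) {n : ℕ}
    (x : Fin n → unitInterval) (G : Sym2 (Fin n) → Bool) : Prop where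
  l1_le : W.sampleL1 c U x ≤ 8 * δ * n ^ 2
  cell_le : ∀ a, |cellDev c a x| ≤ η * n
  codeg_le : codegSq (signDev (W.sampleWeight x) G) ≤ θ ^ 4 * n ^ 4

variable [MeasurableSpace κ] [MeasurableSingletonClass κ]

theorem eventually_sum_atypical_lt {W : Graphon} (hW : Measurable (Function.uncurry W))
    (hW1 : ∀ x y, |W x y| ≤ 1) {c : unitInterval → κ} (hc : Measurable c) {U : κ → κ → ℝ}
    (hU : ∀ a b, |U a b| ≤ 1) {δ η θ : ℝ} (hδ0 : 0 < δ) (hη : 0 < η) (hθ : 0 < θ)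
    (hδ : ∫ p : unitInterval × unitInterval, |W p.1 p.2 - U (c p.1) (c p.2)| ≤ δ) :
    ∀ᶠ n : ℕ in Filter.atTop, ∀ B : Finset (Sym2 (Fin n) → Bool),
      (∀ G ∈ B, ∀ x, ¬ TypicalSample W c U δ η θ x G) →
      ∑ G ∈ B, ∫ x, signWeight (W.sampleWeight x) G < 1 / 2 := by
  -- Failure probabilities of the three conditions: `1/8` by Markov for the `L¹` error, then
  -- Chebyshev summed over the cells, then Markov for the codegrees.
  have hlim : Filter.Tendsto (fun n : ℕ => 1 / 8 + Fintype.card κ / η ^ 2 * (n : ℝ)⁻¹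
      + 32 / θ ^ 4 * (n : ℝ)⁻¹) Filter.atTop
      (nhds (1 / 8 + Fintype.card κ / η ^ 2 * 0 + 32 / θ ^ 4 * 0)) :=
    (tendsto_const_nhds.add (tendsto_inv_atTop_nhds_zero_nat.const_mul _)).add
      (tendsto_inv_atTop_nhds_zero_nat.const_mul _)
  filter_upwards [hlim.eventually_lt_const (u := 1 / 2) (by norm_num), Filter.eventually_gt_atTop 0]
    with n hn hn0 B hB
  have hn0' : (0 : ℝ) < n := Nat.cast_pos.2 hn0
  refine lt_of_le_of_lt ?_ hn
  set P : (Sym2 (Fin n) → Bool) → (Fin n → unitInterval) → ℝ := fun G x =>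
    signWeight (W.sampleWeight x) G with hP
  have hw : ∀ x : Fin n → unitInterval, ∀ e, |W.sampleWeight x e| ≤ 1 :=
    fun x e => abs_sampleWeight_le hW1 x e
  have hP0 : ∀ G x, 0 ≤ P G x := fun G x => signWeight_nonneg (hw x) G
  have hP1 : ∀ G x, P G x ≤ 1 := fun G x => signWeight_le_one (hw x) G
  have hPm : ∀ G, Measurable (P G) := fun G => measurable_signWeight_sampleWeight hW G
  have hPi : ∀ G, Integrable (P G) := fun G =>
    Integrable.of_bound (hPm G).aestronglyMeasurable 1 (.of_forall fun x => by
      rw [Real.norm_eq_abs, abs_of_nonneg (hP0 G x)]; exact hP1 G x)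
  set A : (Fin n → unitInterval) → ℝ := fun x => W.sampleL1 c U x / (8 * δ * n ^ 2)
    + (∑ a, cellDev c a x ^ 2) / (η * n) ^ 2 with hA
  set C : (Sym2 (Fin n) → Bool) → (Fin n → unitInterval) → ℝ := fun G x =>
    codegSq (signDev (W.sampleWeight x) G) / (θ ^ 4 * n ^ 4) with hC
  have hL0 : ∀ x : Fin n → unitInterval, 0 ≤ W.sampleL1 c U x := fun x =>
    Finset.sum_nonneg fun i _ => Finset.sum_nonneg fun j _ => by
      split_ifs
      · exact le_rfl
      · exact abs_nonneg _
  have hD0 : ∀ x : Fin n → unitInterval, 0 ≤ ∑ a, cellDev c a x ^ 2 := fun x =>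
    Finset.sum_nonneg fun a _ => sq_nonneg _
  have hA0 : ∀ x, 0 ≤ A x := fun x =>
    add_nonneg (div_nonneg (hL0 x) (by positivity)) (div_nonneg (hD0 x) (by positivity))
  have hC0 : ∀ G x, 0 ≤ C G x := fun G x => div_nonneg (codegSq_nonneg _) (by positivity)
  have hL := integral_sampleL1_le (V := Fin n) hW hW1 hc hU hδ0.le hδ
  have hD := fun a => integral_cellDev_sq_le (V := Fin n) hc a
  rw [Fintype.card_fin] at hL
  simp only [Fintype.card_fin] at hD
  have hAi : Integrable A :=
    (hL.1.div_const _).add ((integrable_finsetSum _ fun a _ => (hD a).1).div_const _)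
  have hCm : ∀ G, Measurable (C G) := by
    intro G
    refine Measurable.div_const ?_ _
    unfold codegSq
    refine Finset.measurable_sum _ fun j _ => Finset.measurable_sum _ fun k _ =>
      (Finset.measurable_sum _ fun i _ => ?_).pow_const 2
    have hd : ∀ i j, Measurable fun x : Fin n → unitInterval =>
        signDev (W.sampleWeight x) G i j := by
      intro i j
      unfold signDev
      split_ifs
      · exact measurable_const
      · exact measurable_const.sub (measurable_sampleWeight hW _)
    exact (hd i j).mul (hd i k)
  have hCsum : ∀ x, ∑ G, P G x * C G x ≤ 32 / θ ^ 4 * (n : ℝ)⁻¹ := by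
    intro x
    have := sum_signWeight_codegSq_le (hw x)
    rw [Fintype.card_fin] at this
    simp only [hC, hP, mul_div_assoc', ← Finset.sum_div]
    rw [div_le_iff₀ (by positivity)]
    refine this.trans_eq ?_
    field_simp
  have hPC : ∀ G, Integrable fun x => P G x * C G x := by
    intro G
    refine Integrable.of_bound ((hPm G).mul (hCm G)).aestronglyMeasurable (32 / θ ^ 4 * (n : ℝ)⁻¹)
      (.of_forall fun x => ?_)
    rw [Real.norm_eq_abs, abs_of_nonneg (mul_nonneg (hP0 G x) (hC0 G x))]
    exact (Finset.single_le_sum (f := fun G => P G x * C G x)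
      (fun G _ => mul_nonneg (hP0 G x) (hC0 G x)) (Finset.mem_univ G)).trans (hCsum x)
  -- `A` and `C` are sums of nonnegative errors divided by their thresholds, so `A + C < 1` would
  -- make the sample typical.
  have hbad : ∀ G ∈ B, ∀ x, 1 ≤ A x + C G x := by
    intro G hG x
    by_contra hlt
    push Not at hlt
    refine hB G hG x ⟨?_, fun a => ?_, ?_⟩
    · have : W.sampleL1 c U x / (8 * δ * n ^ 2) ≤ 1 := by
        have h1 := hC0 G x
        have h2 : 0 ≤ (∑ a, cellDev c a x ^ 2) / (η * n) ^ 2 := div_nonneg (hD0 x) (by positivity)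
        simp only [hA] at hlt
        linarith
      rwa [div_le_one (by positivity)] at this
    · have : (∑ a, cellDev c a x ^ 2) / (η * n) ^ 2 ≤ 1 := by
        have h1 := hC0 G x
        have h2 : 0 ≤ W.sampleL1 c U x / (8 * δ * n ^ 2) := div_nonneg (hL0 x) (by positivity)
        simp only [hA] at hlt
        linarith
      rw [div_le_one (by positivity)] at this
      refine abs_le_of_sq_le_sq ?_ (by positivity)
      exact (Finset.single_le_sum (f := fun a => cellDev c a x ^ 2)
        (fun a _ => sq_nonneg _) (Finset.mem_univ a)).trans this
    · have : C G x ≤ 1 := by linarith [hA0 x]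
      rwa [hC, div_le_one (by positivity)] at this
  have hAI : ∫ x, A x ≤ 1 / 8 + Fintype.card κ / η ^ 2 * (n : ℝ)⁻¹ := by
    rw [hA, integral_add (hL.1.div_const _)
      ((integrable_finsetSum _ fun a _ => (hD a).1).div_const _), integral_div, integral_div,
      integral_finsetSum _ fun a _ => (hD a).1]
    refine add_le_add ?_ ?_
    · rw [div_le_iff₀ (by positivity)]
      refine hL.2.trans_eq (by ring)
    · rw [div_le_iff₀ (by positivity)]
      refine (Finset.sum_le_sum fun a _ => (hD a).2).trans_eq ?_
      simp
      field_simp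
  have hAP : ∀ G, Integrable fun x => P G x * A x := fun G =>
    hAi.bdd_mul (hPm G).aestronglyMeasurable (c := 1) (.of_forall fun x => by
      rw [Real.norm_eq_abs, abs_of_nonneg (hP0 G x)]; exact hP1 G x)
  calc ∑ G ∈ B, ∫ x, P G x ≤ ∑ G ∈ B, ∫ x, (P G x * A x + P G x * C G x) := by
        refine Finset.sum_le_sum fun G hG => integral_mono (hPi G) ((hAP G).add (hPC G)) fun x => ?_
        have := mul_le_mul_of_nonneg_left (hbad G hG x) (hP0 G x)
        simp only
        linarith
    _ ≤ ∑ G, ∫ x, (P G x * A x + P G x * C G x) :=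
        Finset.sum_le_sum_of_subset_of_nonneg (Finset.subset_univ _) fun G _ _ =>
          integral_nonneg fun x => add_nonneg (mul_nonneg (hP0 G x) (hA0 x))
            (mul_nonneg (hP0 G x) (hC0 G x))
    _ = ∫ x, (A x + ∑ G, P G x * C G x) := by
        rw [← integral_finsetSum Finset.univ (f := fun G x => P G x * A x + P G x * C G x)
          fun G _ => (hAP G).add (hPC G)]
        refine integral_congr_ae (.of_forall fun x => ?_)
        simp only [Finset.sum_add_distrib, ← Finset.sum_mul]
        rw [sum_signWeight, one_mul]
    _ ≤ ∫ x, (A x + 32 / θ ^ 4 * (n : ℝ)⁻¹) :=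
        integral_mono (hAi.add (integrable_finsetSum _ fun G _ => hPC G))
          (hAi.add (integrable_const _)) fun x => add_le_add_right (hCsum x) _
    _ ≤ _ := by
        rw [integral_add hAi (integrable_const _)]
        simp only [integral_const, probReal_univ, one_smul]
        exact add_le_add_left hAI _

/-- If two graphons have the same densities then some sign pattern is typical for both. -/
theorem eventually_exists_typicalSample {W W' : Graphon} (hW : Measurable (Function.uncurry W))
    (hW' : Measurable (Function.uncurry W')) (hW1 : ∀ x y, |W x y| ≤ 1)
    (hW1' : ∀ x y, |W' x y| ≤ 1)
    (h : ∀ (n : ℕ) (E : Finset (Sym2 (Fin n))), (∀ e ∈ E, ¬ e.IsDiag) →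
      pairDensity E W = pairDensity E W')
    {c : unitInterval → κ} (hc : Measurable c) {U U' : κ → κ → ℝ}
    (hU : ∀ a b, |U a b| ≤ 1) (hU' : ∀ a b, |U' a b| ≤ 1) {δ η θ : ℝ} (hδ0 : 0 < δ) (hη : 0 < η)
    (hθ : 0 < θ) (hδ : ∫ p : unitInterval × unitInterval, |W p.1 p.2 - U (c p.1) (c p.2)| ≤ δ)
    (hδ' : ∫ p : unitInterval × unitInterval, |W' p.1 p.2 - U' (c p.1) (c p.2)| ≤ δ) :
    ∀ᶠ n : ℕ in Filter.atTop, ∃ (G : Sym2 (Fin n) → Bool) (x y : Fin n → unitInterval),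
      TypicalSample W c U δ η θ x G ∧ TypicalSample W' c U' δ η θ y G := by
  classical
  filter_upwards [eventually_sum_atypical_lt hW hW1 hc hU hδ0 hη hθ hδ,
    eventually_sum_atypical_lt hW' hW1' hc hU' hδ0 hη hθ hδ'] with n h1 h2
  by_contra hcon
  push Not at hcon
  -- If no pattern served both graphons, `B` would be atypical for `W` and `Bᶜ` for `W'`. Under the
  -- common law both have mass below `1/2`, yet together mass `1`.
  set B : Finset (Sym2 (Fin n) → Bool) :=
    Finset.univ.filter fun G => ∀ x, ¬ TypicalSample W c U δ η θ x G with hB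
  have hb1 := h1 B fun G hG => (Finset.mem_filter.1 hG).2
  have hb2 := h2 Bᶜ fun G hG y hy => by
    simp only [hB, Finset.mem_compl, Finset.mem_filter, Finset.mem_univ, true_and, not_forall,
      not_not] at hG
    obtain ⟨x, hx⟩ := hG
    exact hcon G x y hx hy
  have htot : ∑ G, ∫ x : Fin n → unitInterval, signWeight (W.sampleWeight x) G = 1 := by
    rw [← integral_finsetSum]
    · simp [sum_signWeight]
    · intro G _
      refine Integrable.of_bound
        (measurable_signWeight_sampleWeight hW G).aestronglyMeasurable 1 (.of_forall fun x => ?_)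
      rw [Real.norm_eq_abs, abs_of_nonneg (signWeight_nonneg (abs_sampleWeight_le hW1 x) G)]
      exact signWeight_le_one (abs_sampleWeight_le hW1 x) G
  rw [← Finset.sum_add_sum_compl B] at htot
  simp only [← integral_signWeight_congr hW hW' hW1 hW1' (h n)] at hb2
  linarith

end typical

end Graphon

/-! ### Couplings with prescribed masses on the cells of a partition -/

/-- Shrink `p` by `l = (1 + η)⁻¹`, so that no marginal exceeds its target. The row deficits and the
column deficits each sum to `1 - l`; their product divided by `1 - l` fills the gap. -/
theorem exists_matrix_with_marginals {κ : Type*} [Fintype κ] {p : κ → κ → ℝ} {ν : κ → ℝ} {η : ℝ}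
    (hη : 0 < η) (hp1 : ∑ a, ∑ b, p a b = 1) (hν : ∑ a, ν a = 1)
    (hr : ∀ a, ∑ b, p a b ≤ (1 + η) * ν a) (hc : ∀ b, ∑ a, p a b ≤ (1 + η) * ν b) :
    ∃ π : κ → κ → ℝ, (∀ a b, (1 + η)⁻¹ * p a b ≤ π a b) ∧ (∀ a, ∑ b, π a b = ν a) ∧
      ∀ b, ∑ a, π a b = ν b := by
  set l := (1 + η)⁻¹ with hl
  have hl0 : 0 < 1 + η := by linarith
  have hl1 : 0 < 1 - l := by
    rw [hl, sub_pos]; exact inv_lt_one_of_one_lt₀ (by linarith)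
  have hle : ∀ u v : ℝ, u ≤ (1 + η) * v → 0 ≤ v - l * u := fun u v h => by
    rw [sub_nonneg, hl, inv_mul_le_iff₀ hl0]; exact h
  have hp1' : ∑ b, ∑ a, p a b = 1 := by rw [Finset.sum_comm]; exact hp1
  refine ⟨fun a b => l * p a b
    + (ν a - l * ∑ b', p a b') * (ν b - l * ∑ a', p a' b) / (1 - l), fun a b => ?_, fun a => ?_,
    fun b => ?_⟩
  · exact le_add_of_nonneg_right (div_nonneg (mul_nonneg (hle _ _ (hr a)) (hle _ _ (hc b))) hl1.le)
  · rw [Finset.sum_add_distrib, ← Finset.sum_div, ← Finset.mul_sum, ← Finset.mul_sum,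
      Finset.sum_sub_distrib, ← Finset.mul_sum, hp1', hν]
    field_simp
    ring
  · rw [Finset.sum_add_distrib, ← Finset.sum_div, ← Finset.mul_sum, ← Finset.sum_mul,
      Finset.sum_sub_distrib, ← Finset.mul_sum, hp1, hν]
    field_simp
    ring

namespace Graphon

section cellCoupling

variable {κ : Type*} [Fintype κ] [MeasurableSpace κ] [MeasurableSingletonClass κ]

theorem sum_cell_measureReal {c : unitInterval → κ} (hc : Measurable c) :
    ∑ a, volume.real (c ⁻¹' {a}) = 1 := by
  have := sum_measureReal_preimage_singleton (μ := (volume : Measure unitInterval)) Finset.univ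
    (f := c) (fun a _ => hc (measurableSet_singleton a))
  rw [this]
  simp

/-- Spread the mass `π a b` uniformly over the rectangle of the cells `a` and `b`, using a density
constant on rectangles. -/
theorem exists_coupling_of_matrix {c : unitInterval → κ} (hc : Measurable c)
    (hpos : ∀ a, 0 < volume.real (c ⁻¹' {a})) {π : κ → κ → ℝ} (hπ : ∀ a b, 0 ≤ π a b)
    (hr : ∀ a, ∑ b, π a b = volume.real (c ⁻¹' {a}))
    (hcol : ∀ b, ∑ a, π a b = volume.real (c ⁻¹' {b})) :
    ∃ μ ∈ couplings, ∀ a b, μ.real {p | c p.1 = a ∧ c p.2 = b} = π a b := by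
  set ν : κ → ℝ := fun a => volume.real (c ⁻¹' {a}) with hν
  have hνe : ∀ a, (volume : Measure unitInterval) (c ⁻¹' {a}) = ENNReal.ofReal (ν a) := fun a =>
    (ofReal_measureReal (measure_ne_top _ _)).symm
  set f : κ → κ → ENNReal := fun a b => ENNReal.ofReal (π a b / (ν a * ν b)) with hf
  have hfm : Measurable fun p : unitInterval × unitInterval => f (c p.1) (c p.2) :=
    (measurable_of_countable (fun q : κ × κ => f q.1 q.2)).comp
      (by fun_prop : Measurable fun p : unitInterval × unitInterval => (c p.1, c p.2))
  have hg : ∀ g : κ → ENNReal, ∫⁻ y, g (c y) = ∑ b, g b * ENNReal.ofReal (ν b) := by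
    intro g
    rw [← lintegral_map (measurable_of_countable g) hc, lintegral_fintype]
    refine Finset.sum_congr rfl fun b _ => ?_
    rw [Measure.map_apply hc (measurableSet_singleton b), hνe]
  have hrow : ∀ x : unitInterval, ∫⁻ y, f (c x) (c y) = 1 := by
    intro x
    rw [hg]
    have : ∀ b, f (c x) b * ENNReal.ofReal (ν b) = ENNReal.ofReal (π (c x) b / ν (c x)) := by
      intro b
      rw [hf, ← ENNReal.ofReal_mul (div_nonneg (hπ _ _) (mul_pos (hpos _) (hpos _)).le)]
      congr 1
      have := (hpos b).ne'
      have := (hpos (c x)).ne'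
      simp only [hν]
      field_simp
    simp only [this]
    rw [← ENNReal.ofReal_sum_of_nonneg fun b _ => div_nonneg (hπ _ _) (hpos _).le,
      ← Finset.sum_div, hr, div_self (hpos _).ne', ENNReal.ofReal_one]
  have hcl : ∀ y : unitInterval, ∫⁻ x, f (c x) (c y) = 1 := by
    intro y
    rw [hg fun a => f a (c y)]
    have : ∀ a, f a (c y) * ENNReal.ofReal (ν a) = ENNReal.ofReal (π a (c y) / ν (c y)) := by
      intro a
      rw [hf, ← ENNReal.ofReal_mul (div_nonneg (hπ _ _) (mul_pos (hpos _) (hpos _)).le)]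
      congr 1
      have := (hpos a).ne'
      have := (hpos (c y)).ne'
      simp only [hν]
      field_simp
    simp only [this]
    rw [← ENNReal.ofReal_sum_of_nonneg fun b _ => div_nonneg (hπ _ _) (hpos _).le,
      ← Finset.sum_div, hcol, div_self (hpos _).ne', ENNReal.ofReal_one]
  set μ : Measure (unitInterval × unitInterval) :=
    (volume : Measure (unitInterval × unitInterval)).withDensity
      fun p => f (c p.1) (c p.2) with hμ
  have hprod : ∀ A B : Set unitInterval, MeasurableSet A → MeasurableSet B →
      μ (A ×ˢ B) = ∫⁻ p in A ×ˢ B, f (c p.1) (c p.2) := fun A B hA hB =>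
    withDensity_apply _ (hA.prod hB)
  have hfst : μ.map Prod.fst = volume := by
    ext A hA
    rw [Measure.map_apply measurable_fst hA, ← Set.prod_univ, hprod _ _ hA .univ,
      Measure.volume_eq_prod, ← Measure.prod_restrict, lintegral_prod _ hfm.aemeasurable]
    simp [hrow]
  have hsnd : μ.map Prod.snd = volume := by
    ext A hA
    rw [Measure.map_apply measurable_snd hA, ← Set.univ_prod, hprod _ _ .univ hA,
      Measure.volume_eq_prod, ← Measure.prod_restrict, lintegral_prod_symm _ hfm.aemeasurable]
    simp [hcl]
  refine ⟨μ, ⟨⟨?_⟩, hfst, hsnd⟩, fun a b => ?_⟩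
  · rw [← Set.preimage_univ (f := (Prod.fst : unitInterval × unitInterval → unitInterval)),
      ← Measure.map_apply measurable_fst .univ, hfst, measure_univ]
  · have ha := hc (measurableSet_singleton a)
    have hb := hc (measurableSet_singleton b)
    have hset : {p : unitInterval × unitInterval | c p.1 = a ∧ c p.2 = b}
        = (c ⁻¹' {a}) ×ˢ (c ⁻¹' {b}) := by ext p; simp
    rw [hset, measureReal_def, hprod _ _ ha hb, setLIntegral_congr_fun (ha.prod hb)
      (g := fun _ => f a b) (fun p hp => ?_), setLIntegral_const, Measure.volume_eq_prod,
      Measure.prod_prod, hνe, hνe, hf, ENNReal.toReal_mul, ENNReal.toReal_mul,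
      ENNReal.toReal_ofReal (hpos a).le, ENNReal.toReal_ofReal (hpos b).le,
      ENNReal.toReal_ofReal (div_nonneg (hπ _ _) (mul_pos (hpos _) (hpos _)).le)]
    · exact div_mul_cancel₀ _ (mul_pos (hpos _) (hpos _)).ne'
    · obtain ⟨h1, h2⟩ := hp
      simp only [Set.mem_preimage, Set.mem_singleton_iff] at h1 h2
      simp only [h1, h2]

end cellCoupling

end Graphon

/-! ### Cut norm of step kernels -/

theorem setIntegral_comp_fintype {Ω α : Type*} [MeasurableSpace Ω] [Fintype α] [MeasurableSpace α]
    [MeasurableSingletonClass α] {μ : Measure Ω} [IsFiniteMeasure μ] {C : Ω → α}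
    (hC : Measurable C) (D : α → α → ℝ) (S T : Set Ω) :
    ∫ p in S ×ˢ T, D (C p.1) (C p.2) ∂(μ.prod μ)
      = ∑ a, ∑ b, (μ.restrict S).real (C ⁻¹' {a}) * (μ.restrict T).real (C ⁻¹' {b}) * D a b := by
  have hm : Measurable (Prod.map C C) := hC.prodMap hC
  have h1 : ∫ p in S ×ˢ T, D (C p.1) (C p.2) ∂(μ.prod μ)
      = ∫ q, D q.1 q.2 ∂(((μ.restrict S).map C).prod ((μ.restrict T).map C)) := by
    rw [Measure.map_prod_map _ _ hC hC, Measure.prod_restrict, integral_map hm.aemeasurable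
      (measurable_of_countable _).aestronglyMeasurable]
    rfl
  rw [h1, integral_fintype .of_finite, Fintype.sum_prod_type]
  refine Finset.sum_congr rfl fun a _ => Finset.sum_congr rfl fun b _ => ?_
  rw [← Set.singleton_prod_singleton, measureReal_prod_prod,
    map_measureReal_apply hC (measurableSet_singleton a),
    map_measureReal_apply hC (measurableSet_singleton b), smul_eq_mul]

/-- Here `s` and `t` are `π` times weights in `[0, 1]`, and `π ⊗ π` is `l ^ 2` times `p ⊗ p` plus a
nonnegative remainder of mass `1 - l ^ 2`, on which `|D| ≤ 2`. -/
theorem abs_sum_le_of_matrix_close {α : Type*} [Fintype α] {p π s t : α → ℝ} {D : α → α → ℝ}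
    {l K : ℝ} (hl : 0 ≤ l) (hp : ∀ a, 0 ≤ p a) (hp1 : ∑ a, p a = 1)
    (hπ1 : ∑ a, π a = 1) (hlp : ∀ a, l * p a ≤ π a) (hD : ∀ a b, |D a b| ≤ 2)
    (hs : ∀ a, 0 ≤ s a ∧ s a ≤ π a) (ht : ∀ a, 0 ≤ t a ∧ t a ≤ π a)
    (hK : ∀ σ τ : α → ℝ, (∀ a, |σ a| ≤ 1) → (∀ a, |τ a| ≤ 1) →
      |∑ a, ∑ b, p a * p b * (σ a * τ b * D a b)| ≤ K) :
    |∑ a, ∑ b, s a * t b * D a b| ≤ l ^ 2 * K + 2 * (1 - l ^ 2) := by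
  have hπ : ∀ a, 0 ≤ π a := fun a => (mul_nonneg hl (hp a)).trans (hlp a)
  have hdiv : ∀ u : α → ℝ, (∀ a, 0 ≤ u a ∧ u a ≤ π a) →
      (∀ a, |u a / π a| ≤ 1) ∧ ∀ a, u a = π a * (u a / π a) := by
    intro u hu
    refine ⟨fun a => ?_, fun a => ?_⟩
    · rw [abs_of_nonneg (div_nonneg (hu a).1 (hπ a))]
      exact div_le_one_of_le₀ (hu a).2 (hπ a)
    · rcases (hπ a).eq_or_lt with h | h
      · have := hu a
        rw [← h] at this ⊢
        linarith [this.1, this.2]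
      · field_simp
  obtain ⟨hσ, hsσ⟩ := hdiv s hs
  obtain ⟨hτ, htτ⟩ := hdiv t ht
  set σ := fun a => s a / π a
  set τ := fun a => t a / π a
  have hmass : ∑ a, ∑ b, (π a * π b - l ^ 2 * (p a * p b)) = 1 - l ^ 2 := by
    simp only [Finset.sum_sub_distrib, ← Finset.mul_sum, hp1, hπ1, mul_one]
  have hnn : ∀ a b, 0 ≤ π a * π b - l ^ 2 * (p a * p b) := fun a b => by
    have := mul_le_mul (hlp a) (hlp b) (mul_nonneg hl (hp b)) (hπ a)
    nlinarith
  have hsplit : ∑ a, ∑ b, s a * t b * D a b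
      = l ^ 2 * ∑ a, ∑ b, p a * p b * (σ a * τ b * D a b)
        + ∑ a, ∑ b, (π a * π b - l ^ 2 * (p a * p b)) * (σ a * τ b * D a b) := by
    simp only [Finset.mul_sum, ← Finset.sum_add_distrib]
    refine Finset.sum_congr rfl fun a _ => Finset.sum_congr rfl fun b _ => ?_
    rw [hsσ a, htτ b]
    ring
  rw [hsplit]
  refine (abs_add_le _ _).trans (add_le_add ?_ ?_)
  · rw [abs_mul, abs_of_nonneg (sq_nonneg l)]
    exact mul_le_mul_of_nonneg_left (hK σ τ hσ hτ) (sq_nonneg l)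
  · calc _ ≤ ∑ a, ∑ b, (π a * π b - l ^ 2 * (p a * p b)) * 2 := by
          refine (Finset.abs_sum_le_sum_abs _ _).trans (Finset.sum_le_sum fun a _ =>
            (Finset.abs_sum_le_sum_abs _ _).trans (Finset.sum_le_sum fun b _ => ?_))
          rw [abs_mul, abs_of_nonneg (hnn a b)]
          refine mul_le_mul_of_nonneg_left ?_ (hnn a b)
          rw [abs_mul, abs_mul]
          calc _ ≤ (1 * 1 * 2 : ℝ) := by
                gcongr
                · exact hσ a
                · exact hτ b
                · exact hD a b
            _ = 2 := by norm_num
      _ = _ := by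
          simp only [← Finset.sum_mul, hmass]
          ring

namespace Graphon

/-! ### From a common sign pattern to a coupling. -/

section typicalPair

variable {κ : Type*} [DecidableEq κ] {W W' : Graphon} {c : unitInterval → κ}
  {U U' : κ → κ → ℝ} {δ η θ : ℝ} {n : ℕ} {x y : Fin n → unitInterval} {G : Sym2 (Fin n) → Bool}

theorem TypicalSample.abs_sum_signDev_le (h : TypicalSample W c U δ η θ x G) (hθ : 0 ≤ θ)
    {s t : Fin n → ℝ} (hs : ∀ i, |s i| ≤ 1) (ht : ∀ i, |t i| ≤ 1) :
    |∑ i, ∑ j, s i * t j * signDev (W.sampleWeight x) G i j| ≤ θ * n ^ 2 := by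
  have h1 := pow_four_sum_le_codegSq (signDev (W.sampleWeight x) G) hs ht
  rw [Fintype.card_fin] at h1
  have h2 : (∑ i, ∑ j, s i * t j * signDev (W.sampleWeight x) G i j) ^ 4 ≤ (θ * n ^ 2) ^ 4 := by
    refine h1.trans ((mul_le_mul_of_nonneg_left h.codeg_le (by positivity)).trans_eq (by ring))
  rw [← Even.pow_abs (by decide : Even 4)] at h2
  exact (pow_le_pow_iff_left₀ (abs_nonneg _) (by positivity) (by norm_num)).1 h2

/-- Pass from `U` to `W`, to `G`, to `W'`, to `U'`. The outer passages are small in `L¹` and the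
inner ones in the cut norm. The diagonal, where nothing is known, costs `2 * n`. -/
theorem abs_sum_step_le_of_typicalSample (h : TypicalSample W c U δ η θ x G)
    (h' : TypicalSample W' c U' δ η θ y G) (hU : ∀ a b, |U a b| ≤ 1)
    (hU' : ∀ a b, |U' a b| ≤ 1) (hθ : 0 ≤ θ)
    {s t : Fin n → ℝ} (hs : ∀ i, |s i| ≤ 1) (ht : ∀ i, |t i| ≤ 1) :
    |∑ i, ∑ j, s i * t j * (U (c (x i)) (c (x j)) - U' (c (y i)) (c (y j)))|
      ≤ 2 * n + 16 * δ * n ^ 2 + 2 * θ * n ^ 2 := by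
  set R : Fin n → Fin n → ℝ := fun i j =>
    if i = j then U (c (x i)) (c (x j)) - U' (c (y i)) (c (y j))
    else (W' (y i) (y j) - U' (c (y i)) (c (y j))) - (W (x i) (x j) - U (c (x i)) (c (x j))) with hR
  have hsplit : ∑ i, ∑ j, s i * t j * (U (c (x i)) (c (x j)) - U' (c (y i)) (c (y j)))
      = ∑ i, ∑ j, s i * t j * R i j
        + ∑ i, ∑ j, s i * t j * signDev (W'.sampleWeight y) G i j
        - ∑ i, ∑ j, s i * t j * signDev (W.sampleWeight x) G i j := by
    simp only [← Finset.sum_add_distrib, ← Finset.sum_sub_distrib]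
    refine Finset.sum_congr rfl fun i _ => Finset.sum_congr rfl fun j _ => ?_
    by_cases hij : i = j
    · simp [hR, signDev, hij]
    · have e1 : W.sampleWeight x s(i, j) = W (x i) (x j) :=
        if_neg (mt Sym2.mk_isDiag_iff.1 hij)
      have e2 : W'.sampleWeight y s(i, j) = W' (y i) (y j) :=
        if_neg (mt Sym2.mk_isDiag_iff.1 hij)
      simp only [hR, signDev, if_neg hij, e1, e2]
      ring
  have hRle : |∑ i, ∑ j, s i * t j * R i j| ≤ 2 * n + 16 * δ * n ^ 2 := by
    calc _ ≤ ∑ i, ∑ j, ((if i = j then (2 : ℝ) else 0)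
          + (if i = j then 0 else |W (x i) (x j) - U (c (x i)) (c (x j))|)
          + (if i = j then 0 else |W' (y i) (y j) - U' (c (y i)) (c (y j))|)) := by
          refine (Finset.abs_sum_le_sum_abs _ _).trans (Finset.sum_le_sum fun i _ =>
            (Finset.abs_sum_le_sum_abs _ _).trans (Finset.sum_le_sum fun j _ => ?_))
          rw [abs_mul, abs_mul]
          have hst : |s i| * |t j| ≤ 1 :=
            (mul_le_mul (hs i) (ht j) (abs_nonneg _) zero_le_one).trans_eq (one_mul 1)
          refine (mul_le_mul_of_nonneg_right hst (abs_nonneg _)).trans ?_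
          rw [one_mul]
          simp only [hR]
          split_ifs
          · refine (abs_sub _ _).trans ?_
            linarith [hU (c (x i)) (c (x j)), hU' (c (y i)) (c (y j))]
          · refine (abs_sub _ _).trans ?_
            linarith
      _ = 2 * n + W.sampleL1 c U x + W'.sampleL1 c U' y := by
          simp only [Finset.sum_add_distrib]
          simp [sampleL1, mul_comm]
      _ ≤ _ := by linarith [h.l1_le, h'.l1_le]
  have hA := h.abs_sum_signDev_le hθ hs ht
  have hA' := h'.abs_sum_signDev_le hθ hs ht
  rw [hsplit]
  refine (abs_sub _ _).trans ?_
  have := abs_add_le (∑ i, ∑ j, s i * t j * R i j)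
    (∑ i, ∑ j, s i * t j * signDev (W'.sampleWeight y) G i j)
  linarith

theorem TypicalSample.sum_ite_le (h : TypicalSample W c U δ η θ x G) (hn : 0 < n) {ρ : ℝ} {a : κ}
    (hηρ : η ≤ ρ * volume.real (c ⁻¹' {a})) :
    (∑ i, if c (x i) = a then (1 : ℝ) else 0) / n ≤ (1 + ρ) * volume.real (c ⁻¹' {a}) := by
  have hn' : (0 : ℝ) < n := Nat.cast_pos.2 hn
  have h1 := (abs_le.1 (h.cell_le a)).2
  rw [cellDev, Finset.sum_sub_distrib] at h1
  simp only [Finset.sum_const, Finset.card_univ, Fintype.card_fin, nsmul_eq_mul] at h1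
  rw [div_le_iff₀ hn']
  nlinarith

variable [Fintype κ] [MeasurableSpace κ] [MeasurableSingletonClass κ]

theorem exists_coupling_of_typicalSample (h : TypicalSample W c U δ η θ x G)
    (h' : TypicalSample W' c U' δ η θ y G) (hc : Measurable c)
    (hpos : ∀ a, 0 < volume.real (c ⁻¹' {a})) (hU : ∀ a b, |U a b| ≤ 1)
    (hU' : ∀ a b, |U' a b| ≤ 1) (hδ : 0 ≤ δ) (hθ : 0 ≤ θ) (hn : 0 < n) {ρ : ℝ} (hρ : 0 < ρ)
    (hηρ : ∀ a, η ≤ ρ * volume.real (c ⁻¹' {a})) :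
    ∃ μ ∈ couplings, ∀ S T : Set (unitInterval × unitInterval), MeasurableSet S → MeasurableSet T →
      |∫ p in S ×ˢ T, (U (c p.1.1) (c p.2.1) - U' (c p.1.2) (c p.2.2)) ∂(μ.prod μ)|
        ≤ 2 / n + 16 * δ + 2 * θ + 4 * ρ := by
  have hn' : (0 : ℝ) < n := Nat.cast_pos.2 hn
  -- The empirical distribution of the cell pairs `(c (x i), c (y i))`: the index `i` matches the
  -- two samples.
  set p : κ → κ → ℝ := fun a b =>
    (∑ i, (if c (x i) = a then (1 : ℝ) else 0) * (if c (y i) = b then 1 else 0)) / n with hp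
  have hp0 : ∀ a b, 0 ≤ p a b := fun a b =>
    div_nonneg (Finset.sum_nonneg fun i _ => by split_ifs <;> simp) hn'.le
  have hprow : ∀ a, ∑ b, p a b = (∑ i, if c (x i) = a then (1 : ℝ) else 0) / n := by
    intro a
    simp only [hp]
    rw [← Finset.sum_div, Finset.sum_comm]
    simp
  have hpcol : ∀ b, ∑ a, p a b = (∑ i, if c (y i) = b then (1 : ℝ) else 0) / n := by
    intro b
    simp only [hp]
    rw [← Finset.sum_div, Finset.sum_comm]
    simp
  have hp1 : ∑ a, ∑ b, p a b = 1 := by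
    simp only [hprow]
    rw [← Finset.sum_div, Finset.sum_comm]
    simp [hn'.ne']
  obtain ⟨π, hpπ, hπr, hπc⟩ := exists_matrix_with_marginals hρ hp1 (sum_cell_measureReal hc)
    (fun a => by rw [hprow]; exact h.sum_ite_le hn (hηρ a))
    (fun b => by rw [hpcol]; exact h'.sum_ite_le hn (hηρ b))
  set l := (1 + ρ)⁻¹ with hl
  have hl0 : 0 ≤ l := by positivity
  have hl1 : l ≤ 1 := inv_le_one_of_one_le₀ (by linarith)
  have hlρ : 1 - l ≤ ρ := by
    rw [hl]
    have h1 : (1 + ρ) * (1 + ρ)⁻¹ = 1 := mul_inv_cancel₀ (by linarith)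
    nlinarith
  obtain ⟨μ, hμ, hμπ⟩ := exists_coupling_of_matrix hc hpos
    (fun a b => (mul_nonneg hl0 (hp0 a b)).trans (hpπ a b)) hπr hπc
  have := hμ.1
  refine ⟨μ, hμ, fun S T hS hT => ?_⟩
  set C : unitInterval × unitInterval → κ × κ := fun q => (c q.1, c q.2) with hC
  have hCm : Measurable C := by fun_prop
  have hCπ : ∀ q : κ × κ, μ.real (C ⁻¹' {q}) = π q.1 q.2 := by
    intro q
    rw [← hμπ]
    congr 1
    ext r
    simp [hC, Prod.ext_iff]
  have hemp : ∀ σ τ : κ × κ → ℝ, (∀ q, |σ q| ≤ 1) → (∀ q, |τ q| ≤ 1) →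
      |∑ q : κ × κ, ∑ r : κ × κ, p q.1 q.2 * p r.1 r.2 *
        (σ q * τ r * (U q.1 r.1 - U' q.2 r.2))| ≤ 2 / n + 16 * δ + 2 * θ := by
    intro σ τ hσ hτ
    have hone : ∀ g : κ × κ → ℝ, ∑ q : κ × κ, p q.1 q.2 * g q
        = (∑ i, g (c (x i), c (y i))) / n := by
      intro g
      simp only [hp, div_mul_eq_mul_div, ← Finset.sum_div, Finset.sum_mul]
      rw [Finset.sum_comm]
      congr 1
      refine Finset.sum_congr rfl fun i _ => ?_
      rw [Fintype.sum_prod_type]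
      simp
    have htwo : ∑ q : κ × κ, ∑ r : κ × κ, p q.1 q.2 * p r.1 r.2 *
        (σ q * τ r * (U q.1 r.1 - U' q.2 r.2))
        = (∑ i, ∑ j, σ (c (x i), c (y i)) * τ (c (x j), c (y j)) *
          (U (c (x i)) (c (x j)) - U' (c (y i)) (c (y j)))) / n ^ 2 := by
      simp only [mul_assoc (p _ _) (p _ _), ← Finset.mul_sum]
      rw [hone fun q => ∑ r : κ × κ, p r.1 r.2 * (σ q * τ r * (U q.1 r.1 - U' q.2 r.2))]
      have := fun i => hone fun r => σ (c (x i), c (y i)) * τ r *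
        (U (c (x i)) r.1 - U' (c (y i)) r.2)
      simp only [this]
      rw [← Finset.sum_div, div_div, sq]
    rw [htwo, abs_div, abs_of_pos (by positivity : (0 : ℝ) < n ^ 2), div_le_iff₀ (by positivity)]
    refine (abs_sum_step_le_of_typicalSample h h' hU hU' hθ (fun i => hσ _)
      (fun i => hτ _)).trans_eq ?_
    field_simp
  have hcell : ∀ (A : Set (unitInterval × unitInterval)) (q : κ × κ),
      0 ≤ (μ.restrict A).real (C ⁻¹' {q}) ∧ (μ.restrict A).real (C ⁻¹' {q}) ≤ π q.1 q.2 := by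
    intro A q
    refine ⟨measureReal_nonneg, ?_⟩
    rw [← hCπ]
    exact ENNReal.toReal_mono (measure_ne_top _ _) (Measure.restrict_apply_le _ _)
  rw [setIntegral_comp_fintype hCm (fun q r => U q.1 r.1 - U' q.2 r.2) S T]
  refine (abs_sum_le_of_matrix_close (p := fun q : κ × κ => p q.1 q.2)
    (π := fun q : κ × κ => π q.1 q.2) hl0 (fun q => hp0 _ _)
    (by rw [Fintype.sum_prod_type]; exact hp1)
    (by rw [Fintype.sum_prod_type]; simp only [hπr]; exact sum_cell_measureReal hc)
    (fun q => hpπ _ _) (fun q r => ?_) (hcell S) (hcell T) hemp).trans ?_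
  · refine (abs_sub _ _).trans ?_
    linarith [hU q.1 r.1, hU' q.2 r.2]
  -- The correction of the marginals costs `2 * (1 - l ^ 2) ≤ 4 * (1 - l) ≤ 4 * ρ`.
  · have hK : 0 ≤ 2 / n + 16 * δ + 2 * θ := by positivity
    nlinarith [mul_le_mul_of_nonneg_right (pow_le_one₀ hl0 hl1 : l ^ 2 ≤ 1) hK]

end typicalPair

/-! ### Approximation by step functions -/

/-- The partition of the unit interval into `m + 1` intervals of equal length. -/
noncomputable def gridCell (m : ℕ) (x : unitInterval) : Fin (m + 1) :=
  ⟨min ⌊(m + 1 : ℝ) * x⌋₊ m, Nat.lt_succ_of_le (min_le_right _ _)⟩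

theorem measurable_gridCell (m : ℕ) : Measurable (gridCell m) := by
  have h : Measurable fun x : unitInterval => ⌊(m + 1 : ℝ) * x⌋₊ :=
    Nat.measurable_floor.comp (by fun_prop)
  exact (measurable_of_countable fun k : ℕ =>
    (⟨min k m, Nat.lt_succ_of_le (min_le_right _ _)⟩ : Fin (m + 1))).comp h

theorem gridPoint_mem {m : ℕ} (a : Fin (m + 1)) : (a : ℝ) / (m + 1) ∈ unitInterval := by
  have : (a : ℝ) ≤ m := by exact_mod_cast Nat.lt_succ_iff.1 a.2
  exact ⟨by positivity, div_le_one_of_le₀ (by linarith) (by positivity)⟩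

theorem gridCell_measure_pos (m : ℕ) (a : Fin (m + 1)) :
    0 < volume.real (gridCell m ⁻¹' {a}) := by
  have hm : (0 : ℝ) < m + 1 := by positivity
  have ha : ((a : ℝ) + 1) / (m + 1) ∈ unitInterval := by
    have : (a : ℝ) ≤ m := by exact_mod_cast Nat.lt_succ_iff.1 a.2
    exact ⟨by positivity, div_le_one_of_le₀ (by linarith) (by positivity)⟩
  have hsub : Set.Ioo (⟨(a : ℝ) / (m + 1), gridPoint_mem a⟩ : unitInterval)
      ⟨((a : ℝ) + 1) / (m + 1), ha⟩ ⊆ gridCell m ⁻¹' {a} := by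
    rintro x ⟨h1, h2⟩
    have h1' : (a : ℝ) / (m + 1) < x := h1
    have h2' : (x : ℝ) < ((a : ℝ) + 1) / (m + 1) := h2
    rw [div_lt_iff₀ hm] at h1'
    rw [lt_div_iff₀ hm] at h2'
    have hfl : ⌊(m + 1 : ℝ) * x⌋₊ = a := by
      rw [Nat.floor_eq_iff (mul_nonneg hm.le x.2.1)]
      constructor <;> linarith
    refine Fin.ext ?_
    simp only [gridCell, hfl]
    exact min_eq_left (Nat.lt_succ_iff.1 a.2)
  refine lt_of_lt_of_le ?_ (measureReal_mono hsub)
  rw [measureReal_def, unitInterval.volume_Ioo, ENNReal.toReal_ofReal_eq_iff.2]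
  · rw [sub_pos]
    exact (div_lt_div_iff_of_pos_right hm).2 (by linarith)
  · rw [sub_nonneg]
    exact (div_le_div_iff_of_pos_right hm).2 (by linarith)

theorem dist_gridPoint_le (m : ℕ) (x : unitInterval) :
    dist x ⟨(gridCell m x : ℝ) / (m + 1), gridPoint_mem _⟩ ≤ 1 / (m + 1) := by
  have hm : (0 : ℝ) < m + 1 := by positivity
  have hx0 : (0 : ℝ) ≤ (m + 1 : ℝ) * x := mul_nonneg hm.le x.2.1
  have hx1 : (m + 1 : ℝ) * x ≤ m + 1 := mul_le_of_le_one_right hm.le x.2.2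
  have key : |(m + 1 : ℝ) * x - (gridCell m x : ℕ)| ≤ 1 := by
    simp only [gridCell]
    rcases le_total ⌊(m + 1 : ℝ) * x⌋₊ m with h | h
    · rw [min_eq_left h, abs_le]
      have := Nat.floor_le hx0
      have := Nat.lt_floor_add_one ((m + 1 : ℝ) * x)
      constructor <;> linarith
    -- This case contains the endpoint `x = 1`, where the floor is `m + 1` and the truncation keeps
    -- the point in the last cell.
    · rw [min_eq_right h, abs_le]
      have : (m : ℝ) ≤ (m + 1 : ℝ) * x := (Nat.cast_le.2 h).trans (Nat.floor_le hx0)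
      constructor <;> linarith
  rw [Subtype.dist_eq, Real.dist_eq, le_div_iff₀ hm]
  calc _ = |((x : ℝ) - (gridCell m x : ℕ) / (m + 1)) * (m + 1)| := by
        rw [abs_mul, abs_of_pos hm]
    _ = |(m + 1 : ℝ) * x - (gridCell m x : ℕ)| := by
        congr 1
        field_simp
    _ ≤ 1 := key

/-- Approximate in `L¹` by a continuous function, which is uniformly continuous, and read it off at
grid points. Having this for all large `m` lets two graphons share a grid. -/
theorem eventually_exists_step {W : Graphon} (hW : Measurable (Function.uncurry W))
    (hW1 : ∀ x y, |W x y| ≤ 1) {δ : ℝ} (hδ : 0 < δ) :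
    ∀ᶠ m : ℕ in Filter.atTop, ∃ U : Fin (m + 1) → Fin (m + 1) → ℝ, (∀ a b, |U a b| ≤ 1) ∧
      ∫ p : unitInterval × unitInterval, |W p.1 p.2 - U (gridCell m p.1) (gridCell m p.2)| ≤ δ := by
  have hWi : Integrable (Function.uncurry W) (volume : Measure (unitInterval × unitInterval)) :=
    Integrable.of_bound hW.aestronglyMeasurable 1 (.of_forall fun p => hW1 _ _)
  obtain ⟨g, hg, hgi⟩ := hWi.exists_boundedContinuous_integral_sub_le (half_pos hδ)
  have huc : UniformContinuous g := CompactSpace.uniformContinuous_of_continuous g.continuous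
  obtain ⟨r, hr, hgr⟩ := Metric.uniformContinuous_iff.1 huc (δ / 2) (half_pos hδ)
  have hlim : ∀ᶠ m : ℕ in Filter.atTop, 1 / ((m : ℝ) + 1) < r :=
    tendsto_one_div_add_atTop_nhds_zero_nat.eventually_lt_const hr
  filter_upwards [hlim] with m hm
  let q : Fin (m + 1) → unitInterval := fun a => ⟨(a : ℝ) / (m + 1), gridPoint_mem a⟩
  let U : Fin (m + 1) → Fin (m + 1) → ℝ := fun a b => max (-1) (min 1 (g (q a, q b)))
  have hU : ∀ a b, |U a b| ≤ 1 := fun a b =>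
    abs_le.2 ⟨le_max_left _ _, max_le (by norm_num) (min_le_left _ _)⟩
  refine ⟨U, hU, ?_⟩
  have hpt : ∀ p : unitInterval × unitInterval,
      |W p.1 p.2 - U (gridCell m p.1) (gridCell m p.2)|
        ≤ ‖Function.uncurry W p - g p‖ + δ / 2 := by
    intro p
    have h1 : |W p.1 p.2 - U (gridCell m p.1) (gridCell m p.2)|
        ≤ |W p.1 p.2 - g (q (gridCell m p.1), q (gridCell m p.2))| := by
      -- Truncation to `[-1, 1]` is 1-Lipschitz and fixes `W`, so it cannot increase the error.
      have hw := abs_le.1 (hW1 p.1 p.2)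
      have hw' : W p.1 p.2 = max (-1) (min 1 (W p.1 p.2)) := by
        rw [min_eq_right hw.2, max_eq_right hw.1]
      conv_lhs => rw [hw']
      refine (abs_max_sub_max_le_max _ _ _ _).trans ?_
      rw [sub_self, abs_zero, max_eq_right (abs_nonneg _)]
      refine (abs_min_sub_min_le_max _ _ _ _).trans ?_
      rw [sub_self, abs_zero, max_eq_right (abs_nonneg _)]
    have h2 : dist (g p) (g (q (gridCell m p.1), q (gridCell m p.2))) < δ / 2 := by
      refine hgr (lt_of_le_of_lt ?_ hm)
      rw [Prod.dist_eq]
      exact max_le (dist_gridPoint_le m p.1) (dist_gridPoint_le m p.2)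
    rw [Real.dist_eq] at h2
    have h3 := abs_sub_le (W p.1 p.2) (g p) (g (q (gridCell m p.1), q (gridCell m p.2)))
    rw [Real.norm_eq_abs]
    change _ ≤ |W p.1 p.2 - g p| + δ / 2
    linarith
  have hi : Integrable fun p => ‖Function.uncurry W p - g p‖ := (hWi.sub hgi).norm
  calc _ ≤ ∫ p, (‖Function.uncurry W p - g p‖ + δ / 2) :=
        integral_mono_of_nonneg (.of_forall fun p => abs_nonneg _) (hi.add (integrable_const _))
          (.of_forall hpt)
    _ ≤ δ := by
        rw [integral_add hi (integrable_const _)]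
        simp only [integral_const, probReal_univ, one_smul]
        linarith

end Graphon

/-! ### Choice of parameters, rescaling, and the converse direction. -/

namespace Graphon

theorem exists_coupling_overlayIntegral_le {W W' : Graphon} (hW : Measurable (Function.uncurry W))
    (hW' : Measurable (Function.uncurry W')) (hW1 : ∀ x y, |W x y| ≤ 1)
    (hW1' : ∀ x y, |W' x y| ≤ 1)
    (h : ∀ (n : ℕ) (E : Finset (Sym2 (Fin n))), (∀ e ∈ E, ¬ e.IsDiag) →
      pairDensity E W = pairDensity E W') {ε : ℝ} (hε : 0 < ε) :
    ∃ μ ∈ couplings, ∀ S T : Set (unitInterval × unitInterval), MeasurableSet S → MeasurableSet T →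
      |overlayIntegral W W' μ S T| ≤ ε := by
  -- The total error is at most `26 * δ`: the coupling gives `2 / n + 16δ + 2δ + 4δ` with `2 / n ≤
  -- 2δ`, and the two step approximations give `δ` each.
  set δ := ε / 40 with hδdef
  have hδ : 0 < δ := by positivity
  obtain ⟨m, ⟨U, hU, hUW⟩, ⟨U', hU', hUW'⟩⟩ :=
    ((eventually_exists_step hW hW1 hδ).and (eventually_exists_step hW' hW1' hδ)).exists
  set c := gridCell m
  have hc : Measurable c := measurable_gridCell m
  have hpos := gridCell_measure_pos m
  -- The cell tolerance is `δ` times the smallest cell measure, hence a relative error of at most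
  -- `δ` in every cell.
  obtain ⟨a₀, ha₀⟩ := Finite.exists_min fun a : Fin (m + 1) => volume.real (c ⁻¹' {a})
  obtain ⟨n, ⟨G, x, y, hx, hy⟩, hn0, hn⟩ :=
    ((eventually_exists_typicalSample hW hW' hW1 hW1' h hc hU hU' hδ
      (mul_pos hδ (hpos a₀)) hδ hUW hUW').and ((Filter.eventually_gt_atTop 0).and
      ((tendsto_inv_atTop_nhds_zero_nat (𝕜 := ℝ)).eventually_lt_const hδ))).exists
  obtain ⟨μ, hμ, hμU⟩ := exists_coupling_of_typicalSample hx hy hc hpos hU hU' hδ.le hδ.le hn0 hδ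
    fun a => mul_le_mul_of_nonneg_left (ha₀ a) hδ.le
  refine ⟨μ, hμ, fun S T hS hT => ?_⟩
  have := hμ.1
  have hp1 : MeasurePreserving Prod.fst μ volume := ⟨measurable_fst, hμ.2.1⟩
  have hp2 : MeasurePreserving Prod.snd μ volume := ⟨measurable_snd, hμ.2.2⟩
  have herr : ∀ (X : Graphon) (Z : Fin (m + 1) → Fin (m + 1) → ℝ)
      (π : unitInterval × unitInterval → unitInterval), Measurable (Function.uncurry X) →
      (∀ x y, |X x y| ≤ 1) → (∀ a b, |Z a b| ≤ 1) → MeasurePreserving π μ volume →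
      ∫ p : unitInterval × unitInterval, |X p.1 p.2 - Z (c p.1) (c p.2)| ≤ δ →
      Integrable (fun p => X (π p.1) (π p.2) - Z (c (π p.1)) (c (π p.2)))
        ((μ.prod μ).restrict (S ×ˢ T)) ∧
      |∫ p in S ×ˢ T, (X (π p.1) (π p.2) - Z (c (π p.1)) (c (π p.2))) ∂(μ.prod μ)| ≤ δ := by
    intro X Z π hX hX1 hZ hπ hXZ
    have hm : Measurable fun p : unitInterval × unitInterval => X p.1 p.2 - Z (c p.1) (c p.2) :=
      hX.sub (measurable_cellStep hc Z)
    have hππ := hπ.prod hπ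
    have hi : Integrable (fun p => X (π p.1) (π p.2) - Z (c (π p.1)) (c (π p.2))) (μ.prod μ) :=
      Integrable.of_bound (hm.comp hππ.measurable).aestronglyMeasurable (1 + 1)
        (.of_forall fun p => (abs_sub _ _).trans (add_le_add (hX1 _ _) (hZ _ _)))
    refine ⟨hi.restrict, ?_⟩
    refine (abs_integral_le_integral_abs).trans ((setIntegral_le_integral hi.abs
      (.of_forall fun p => abs_nonneg _)).trans (le_of_eq_of_le ?_ hXZ))
    rw [Measure.volume_eq_prod, ← hππ.map_eq,
      integral_map hππ.aemeasurable hm.abs.aestronglyMeasurable]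
    rfl
  obtain ⟨hi1, he1⟩ := herr W U Prod.fst hW hW1 hU hp1 hUW
  obtain ⟨hi2, he2⟩ := herr W' U' Prod.snd hW' hW1' hU' hp2 hUW'
  have hi3 : Integrable (fun p : (unitInterval × unitInterval) × (unitInterval × unitInterval) =>
      U (c p.1.1) (c p.2.1) - U' (c p.1.2) (c p.2.2)) ((μ.prod μ).restrict (S ×ˢ T)) := by
    refine Integrable.of_bound (((measurable_cellStep hc U).comp
      (hp1.prod hp1).measurable).sub ((measurable_cellStep hc U').comp
      (hp2.prod hp2).measurable)).aestronglyMeasurable (1 + 1)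
      (.of_forall fun p => (abs_sub _ _).trans (add_le_add (hU _ _) (hU' _ _)))
  have hsplit : overlayIntegral W W' μ S T
      = (∫ p in S ×ˢ T, (U (c p.1.1) (c p.2.1) - U' (c p.1.2) (c p.2.2)) ∂(μ.prod μ))
        + (∫ p in S ×ˢ T, (W p.1.1 p.2.1 - U (c p.1.1) (c p.2.1)) ∂(μ.prod μ))
        - ∫ p in S ×ˢ T, (W' p.1.2 p.2.2 - U' (c p.1.2) (c p.2.2)) ∂(μ.prod μ) := by
    rw [← integral_add' hi3 hi1, ← integral_sub (hi3.add hi1) hi2]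
    refine integral_congr_ae (.of_forall fun p => ?_)
    simp only [Pi.add_apply]
    ring
  have hst := hμU S T hS hT
  rw [hsplit]
  have hn2 : 2 / (n : ℝ) ≤ 2 * δ := by
    rw [div_eq_mul_inv]
    linarith
  rw [abs_le] at *
  constructor <;> linarith [hst.1, hst.2, he1.1, he1.2, he2.1, he2.2]

/-- The graphon multiplied by a constant. -/
def constMul (r : ℝ) (W : Graphon) : Graphon where
  toFun x y := r * W x y
  symm' x y := by rw [W.symm']
  bounded' := by
    obtain ⟨C, hC⟩ := W.bounded'
    exact ⟨|r| * C, fun x y => by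
      rw [abs_mul]; exact mul_le_mul_of_nonneg_left (hC x y) (abs_nonneg r)⟩
  aemeasurable' := W.aemeasurable'.const_mul r

theorem pairDensity_constMul {V : Type*} [Fintype V] (E : Finset (Sym2 V)) (r : ℝ) (W : Graphon) :
    pairDensity E (W.constMul r) = r ^ E.card * pairDensity E W := by
  unfold pairDensity
  rw [← integral_const_mul]
  refine integral_congr_ae (.of_forall fun x => ?_)
  simp only
  rw [← Finset.prod_const, ← Finset.prod_mul_distrib]
  refine Finset.prod_congr rfl fun e _ => ?_
  induction e with | _ i j => rfl

theorem overlayIntegral_constMul (r : ℝ) (W W' : Graphon)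
    (μ : Measure (unitInterval × unitInterval)) (S T : Set (unitInterval × unitInterval)) :
    overlayIntegral (W.constMul r) (W'.constMul r) μ S T = r * overlayIntegral W W' μ S T := by
  unfold overlayIntegral
  rw [← integral_const_mul]
  exact integral_congr_ae (.of_forall fun p => (mul_sub _ _ _).symm)

theorem pairDensity_eq_homDensity {V : Type*} [Fintype V] {E : Finset (Sym2 V)}
    (hE : ∀ e ∈ E, ¬ e.IsDiag) (W : Graphon) :
    pairDensity E W = homDensity (SimpleGraph.fromEdgeSet (E : Set (Sym2 V))) W := by
  classical
  have : (SimpleGraph.fromEdgeSet (E : Set (Sym2 V))).edgeFinset = E := by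
    ext e
    rw [SimpleGraph.mem_edgeFinset, SimpleGraph.edgeSet_fromEdgeSet]
    simp only [Set.mem_sdiff, Finset.mem_coe]
    exact ⟨fun h => h.1, fun h => ⟨h, hE e h⟩⟩
  unfold pairDensity homDensity
  conv_lhs => rw [← this]
  congr!

theorem cutDist_eq_zero_of_homDensity_eq {W W' : Graphon}
    (h : ∀ (k : ℕ) (F : SimpleGraph (Fin k)), homDensity F W = homDensity F W') :
    cutDist W W' = 0 := by
  obtain ⟨W₀, hW₀, hWW₀⟩ := W.exists_measurable_ae_eq
  obtain ⟨W₀', hW₀', hWW₀'⟩ := W'.exists_measurable_ae_eq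
  obtain ⟨C, hC⟩ := W₀.bounded'
  obtain ⟨C', hC'⟩ := W₀'.bounded'
  -- Dividing both graphons by `M` bounds them by `1`, as sign means must be. Densities scale by the
  -- same power of `M⁻¹` on both sides, and overlay integrals scale by `M⁻¹`.
  set M := max 1 (max C C') with hM
  have hM0 : 0 < M := lt_of_lt_of_le one_pos (le_max_left _ _)
  have hsc : ∀ (X : Graphon), (∀ x y, |X x y| ≤ M) → ∀ x y, |X.constMul M⁻¹ x y| ≤ 1 := by
    intro X hX x y
    change |M⁻¹ * X x y| ≤ 1
    rw [abs_mul, abs_of_pos (inv_pos.2 hM0), inv_mul_le_one₀ hM0]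
    exact hX x y
  have hd : ∀ (n : ℕ) (E : Finset (Sym2 (Fin n))), (∀ e ∈ E, ¬ e.IsDiag) →
      pairDensity E (W₀.constMul M⁻¹) = pairDensity E (W₀'.constMul M⁻¹) := by
    intro n E hE
    rw [pairDensity_constMul, pairDensity_constMul, ← pairDensity_congr_ae hE hWW₀,
      ← pairDensity_congr_ae hE hWW₀', pairDensity_eq_homDensity hE, pairDensity_eq_homDensity hE,
      h]
  have hnn : ∀ μ : couplings, 0 ≤ overlayCutDist W W' μ := fun μ =>
    Real.iSup_nonneg fun _ => abs_nonneg _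
  refine le_antisymm (le_of_forall_pos_le_add fun ε hε => ?_) (Real.iInf_nonneg hnn)
  obtain ⟨μ, hμ, hμε⟩ := exists_coupling_overlayIntegral_le (W := W₀.constMul M⁻¹)
    (W' := W₀'.constMul M⁻¹) (hW₀.const_mul M⁻¹)
    (hW₀'.const_mul M⁻¹)
    (hsc W₀ fun x y => (hC x y).trans ((le_max_left _ _).trans (le_max_right _ _)))
    (hsc W₀' fun x y => (hC' x y).trans ((le_max_right _ _).trans (le_max_right _ _)))
    hd (div_pos hε hM0)
  rw [zero_add]
  refine (ciInf_le ⟨0, by rintro _ ⟨ν, rfl⟩; exact hnn ν⟩ (⟨μ, hμ⟩ : couplings)).trans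
    (Real.iSup_le (fun ST => ?_) hε.le)
  have := hμε ST.1 ST.2 ST.1.2 ST.2.2
  rw [overlayIntegral_constMul, abs_mul, abs_of_pos (inv_pos.2 hM0), inv_mul_eq_div,
    div_le_div_iff_of_pos_right hM0] at this
  rwa [overlayIntegral_congr_ae hWW₀ hWW₀' hμ]

end Graphon

theorem corollary3p10 (W W' : Graphon) :
    Graphon.cutDist W W' = 0 ↔
      ∀ (k : ℕ) (F : SimpleGraph (Fin k)), Graphon.homDensity F W = Graphon.homDensity F W' :=
  ⟨fun h _ F => Graphon.homDensity_eq_of_cutDist_eq_zero h F,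
    Graphon.cutDist_eq_zero_of_homDensity_eq⟩
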